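/- A \emph{symmetric space} $X$ on $[0,1]$ is a Banach space of (a.e.-classes of) real Lebesgue measurable functions on $[0,1]$ such that (i) if $y\in X$, $x$ is measurable and $|x|\le|y|$ a.e., then $x\in X$ and $\|x\|_X\le\|y\|_X$; (ii) if $y\in X$ and $x$ is measurable with $m\{|x|>s\}=m\{|y|>s\}$ for all $s>0$, then $x\in X$ and $\|x\|_X=\|y\|_X$; and, as normalization, $\|\chi_{[0,1]}\|_X=1$. For measurable $z$ on the square $[0,1]^2$ let $z^{\circledast}$ be the decreasing rearrangement of $|z|$ on $[0,1]$ with respect to planar Lebesgue measure, and let $X(I\times I)$ be the set of $z$ with $z^{\circledast}\in X$, with $\|z\|_{X(I\times I)}=\|z^{\circledast}\|_X$. The \emph{multiplicator space} $\mathscr M(X)$ is the set of measurable $x$ on $[0,1]$ for which $y\mapsto x\otimes y$, $(x\otimes y)(s,t)=x(s)y(t)$, is bounded from $X$ into $X(I\times I)$; $\|x\|_{\mathscr M(X)}$ is the norm of this operator. Let $V_0f(t)=f(2t)$ for $0\le t\le\frac12$ and $V_0f(t)=0$ otherwise, $V_1f(t)=f(2t-1)$ for $\frac12\le t\le1$ and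 $V_1f(t)=0$ otherwise; for $\alpha=(\alpha_1,\dots,\alpha_k)\in\{0,1\}^k$ put $|\alpha|=k$ and $V^\alpha=V_{\alpha_1}\cdots V_{\alpha_k}$. For $f\in X$ and $k_0\ge0$, the system $\{V^\alpha f\}_{|\alpha|\ge k_0}$ is an \emph{absolutely representing system in $X$ with the constant $C>0$} if for every $x\in X$ there are real coefficients $\xi_\alpha$, $|\alpha|\ge k_0$, such that $$x=\sum_{|\alpha|\ge k_0}\xi_\alpha V^\alpha f\ \text{ (unconditionally in } X)\quad\text{and}\quad \sum_{k=k_0}^\infty\Bigl\|\sum_{|\alpha|=k}\xi_\alpha V^\alpha f\Bigr\|_X\le C\|x\|_X .$$ \textbf{Theorem.} Let $X$ be a separable symmetric space on $[0,1]$ and let $f\in X$ satisfy $\int_0^1f(t)\,dt\ne0$. Then the following are equivalent: (i) $f\in\mathscr M(X)$; (ii) there is a constant $C>0$ such that for every $k_0\ge0$ the system $\{V^\alpha f\}_{|\alpha|\ge k_0}$ is an absolutely representing system in $X$ with the constant $C$. Moreover, if $f\in\mathscr M(X)$, then in (ii) every constant $C>\|f\|_{\mathscr M(X)}\big/\bigl|\int_0^1f(t)\,dt\bigr|$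 can be taken. -/

import Mathlib

open MeasureTheory TopologicalSpace

noncomputable section

namespace DyadicSystem

/-- Lebesgue measure on `[0,1]`, regarded as a measure on `ℝ`. -/
abbrev mI : Measure ℝ := volume.restrict (Set.Icc (0 : ℝ) 1)

/-- Real measurable functions on `[0,1]`, with identification almost everywhere. -/
abbrev L0 : Type := ℝ →ₘ[mI] ℝ

/-- Real measurable functions on the square `[0,1] × [0,1]`, with identification a.e. -/
abbrev L0Sq : Type := (ℝ × ℝ) →ₘ[mI.prod mI] ℝ

/-- `x` and `y` are equimeasurable: `|x|` and `|y|` have the same distribution function. -/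
def Equimeasurable (x y : L0) : Prop :=
  ∀ s : ℝ, 0 < s → mI {t | s < |x t|} = mI {t | s < |y t|}

/-- A normed linear space of (classes of) real measurable functions on `[0,1]`. -/
structure NormedFunctionSpace where
  /-- the functions belonging to the space -/
  carrier : Submodule ℝ L0
  /-- the norm of the space -/
  normOf : carrier → ℝ
  norm_nonneg : ∀ x, 0 ≤ normOf x
  norm_smul : ∀ (c : ℝ) x, normOf (c • x) = |c| * normOf x
  norm_add_le : ∀ x y, normOf (x + y) ≤ normOf x + normOf y
  eq_zero_of_norm_eq_zero : ∀ x, normOf x = 0 → x = 0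

instance : CoeSort NormedFunctionSpace Type := ⟨fun X => X.carrier⟩

instance (X : NormedFunctionSpace) : Norm X := ⟨X.normOf⟩

theorem NormedFunctionSpace.core (X : NormedFunctionSpace) : NormedSpace.Core ℝ X where
  norm_nonneg := X.norm_nonneg
  norm_smul := X.norm_smul
  norm_triangle := X.norm_add_le
  norm_eq_zero_iff x := by
    refine ⟨X.eq_zero_of_norm_eq_zero x, ?_⟩
    rintro rfl
    have h := X.norm_smul 0 0
    simp only [zero_smul, abs_zero, zero_mul] at h
    exact h

instance (X : NormedFunctionSpace) : NormedAddCommGroup X := NormedAddCommGroup.ofCore X.core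

instance (X : NormedFunctionSpace) : NormedSpace ℝ X := NormedSpace.ofCore X.core

/-- A symmetric (rearrangement invariant) space on `[0,1]`: a Banach space of measurable functions
that is an ideal lattice, is invariant under equimeasurability, and is normalized so that the
constant function `1` has norm `1`. -/
structure SymmetricSpace where
  /-- the underlying normed space of functions -/
  space : NormedFunctionSpace
  complete : CompleteSpace space
  ideal : ∀ (x : L0) (y : space), (∀ᵐ t ∂mI, |x t| ≤ |(y : L0) t|) →
    ∃ hx : x ∈ space.carrier, ‖(⟨x, hx⟩ : space)‖ ≤ ‖y‖
  symmetric : ∀ (x : L0) (y : space), Equimeasurable x y →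
    ∃ hx : x ∈ space.carrier, ‖(⟨x, hx⟩ : space)‖ = ‖y‖
  norm_one : ∃ h : (1 : L0) ∈ space.carrier, ‖(⟨1, h⟩ : space)‖ = 1

instance : CoeSort SymmetricSpace Type := ⟨fun X => X.space⟩

/-! ### Rearrangement on the square and the multiplicator space -/

/-- The decreasing rearrangement
`z^⊛(t) = inf {s ≥ 0 : m₂{(u,v) : |z(u,v)| > s} ≤ t}` of a function on the square. -/
def rearrFun (z : L0Sq) (t : ℝ) : ℝ :=
  sInf {s : ℝ | 0 ≤ s ∧ (mI.prod mI) {p | s < |z p|} ≤ ENNReal.ofReal t}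

/-- For `t > 0` the infimum defining the rearrangement is over a nonempty set. -/
theorem rearr_nonempty (z : L0Sq) {t : ℝ} (ht : 0 < t) :
    {s : ℝ | 0 ≤ s ∧ (mI.prod mI) {p | s < |z p|} ≤ ENNReal.ofReal t}.Nonempty := by
  have hm : ∀ n : ℕ, MeasurableSet {p | (n : ℝ) < |z p|} := fun n =>
    measurableSet_lt measurable_const z.stronglyMeasurable.measurable.abs
  have hlim : Filter.Tendsto (fun n : ℕ => (mI.prod mI) {p | (n : ℝ) < |z p|}) Filter.atTop
      (nhds ((mI.prod mI) (⋂ n : ℕ, {p | (n : ℝ) < |z p|}))) := by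
    refine tendsto_measure_iInter_atTop (fun n => (hm n).nullMeasurableSet) ?_
      ⟨0, measure_ne_top _ _⟩
    intro m n hmn p hp
    exact lt_of_le_of_lt (Nat.cast_le.mpr hmn : (m : ℝ) ≤ n) hp
  have hempty : (⋂ n : ℕ, {p | (n : ℝ) < |z p|}) = ∅ := by
    ext p
    simp only [Set.mem_iInter, Set.mem_ofPred_eq, Set.mem_empty_iff_false, iff_false, not_forall,
      not_lt]
    exact exists_nat_ge _
  rw [hempty, measure_empty] at hlim
  obtain ⟨n, hn⟩ := (hlim.eventually
    (gt_mem_nhds (ENNReal.ofReal_pos.mpr ht))).exists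
  exact ⟨n, Nat.cast_nonneg n, hn.le⟩

theorem rearrFun_antitoneOn (z : L0Sq) : AntitoneOn (rearrFun z) (Set.Ioi 0) := by
  intro a ha b _ hab
  refine csInf_le_csInf ⟨0, fun s hs => hs.1⟩ (rearr_nonempty z ha) ?_
  exact fun s hs => ⟨hs.1, hs.2.trans (ENNReal.ofReal_le_ofReal hab)⟩

theorem rearrFun_aestronglyMeasurable (z : L0Sq) : AEStronglyMeasurable (rearrFun z) mI := by
  have h := aemeasurable_restrict_of_antitoneOn (μ := volume) measurableSet_Ioc
    ((rearrFun_antitoneOn z).mono (Set.Ioc_subset_Ioi_self : Set.Ioc (0 : ℝ) 1 ⊆ Set.Ioi 0))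
  rw [restrict_Ioc_eq_restrict_Icc] at h
  exact h.aestronglyMeasurable

/-- The decreasing rearrangement of a function on the square, as a function on `[0,1]`. -/
def rearr (z : L0Sq) : L0 := AEEqFun.mk (rearrFun z) (rearrFun_aestronglyMeasurable z)

/-- The tensor product `(x ⊗ y)(s,t) = x(s) y(t)`. -/
def tensor (x y : L0) : L0Sq :=
  AEEqFun.mk (fun p : ℝ × ℝ => x p.1 * y p.2)
    ((x.stronglyMeasurable.comp_measurable measurable_fst).mul
      (y.stronglyMeasurable.comp_measurable measurable_snd)).aestronglyMeasurable

/-- The functions of the symmetric space `X(I × I)` on the square. -/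
def squareSet (X : SymmetricSpace) : Set L0Sq := {z | rearr z ∈ X.space.carrier}

/-- The norm of `X(I × I)`. -/
def squareNorm (X : SymmetricSpace) (z : squareSet X) : ℝ := ‖(⟨rearr z, z.2⟩ : X)‖

/-- `C` bounds the operator `y ↦ x ⊗ y` from `X` into `X(I × I)`. -/
def TensorBound (X : SymmetricSpace) (x : L0) (C : ℝ) : Prop :=
  0 ≤ C ∧ ∀ y : X, ∃ h : tensor x y ∈ squareSet X, squareNorm X ⟨tensor x y, h⟩ ≤ C * ‖y‖

/-- The multiplicator space of `X`: those `x` for which `y ↦ x ⊗ y` is bounded from `X` into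
`X(I × I)`. -/
def multiplicator (X : SymmetricSpace) : Set L0 := {x | ∃ C, TensorBound X x C}

/-- The norm of the multiplicator space: the operator norm of `y ↦ x ⊗ y`. -/
def multiplicatorNorm (X : SymmetricSpace) (x : L0) : ℝ := sInf {C | TensorBound X x C}

/-! ### Dyadic dilations and translations -/

/-- The dyadic half `[0,1/2]` (for `false`, the digit `0`) or `[1/2,1]` (for `true`, the
digit `1`). -/
def half (b : Bool) : Set ℝ := if b then Set.Icc (1 / 2) 1 else Set.Icc 0 (1 / 2)

/-- `t ↦ 2t` (digit `0`) or `t ↦ 2t - 1` (digit `1`). -/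
def stretch (b : Bool) (t : ℝ) : ℝ := if b then 2 * t - 1 else 2 * t

theorem measurableSet_half (b : Bool) : MeasurableSet (half b) := by
  cases b <;> exact measurableSet_Icc

theorem measurable_stretch (b : Bool) : Measurable (stretch b) := by
  cases b
  · exact measurable_const.mul measurable_id
  · exact (measurable_const.mul measurable_id).sub_const 1

/-- The operators `V₀` and `V₁`: `V_b x (t) = x (2t - b)` for `t` in the corresponding half of
`[0,1]`, and `0` elsewhere. -/
def V (b : Bool) (x : L0) : L0 :=
  AEEqFun.mk ((half b).indicator fun t => x (stretch b t))
    ((x.stronglyMeasurable.comp_measurable (measurable_stretch b)).indicator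
      (measurableSet_half b)).aestronglyMeasurable

/-- The doubling map of `[0,1]`. -/
def dbl (t : ℝ) : ℝ := if t < 1 / 2 then 2 * t else 2 * t - 1

theorem measurable_dbl : Measurable dbl :=
  Measurable.ite measurableSet_Iio (measurable_const.mul measurable_id)
    ((measurable_const.mul measurable_id).sub_const 1)

theorem mI_dbl_preimage {A : Set ℝ} (hA : MeasurableSet A) : mI (dbl ⁻¹' A) = mI A := by
  rw [Measure.restrict_apply (measurable_dbl hA), Measure.restrict_apply hA]
  have hsplit : dbl ⁻¹' A ∩ Set.Icc 0 1 =
      ((fun t => (2 : ℝ) * t) ⁻¹' (A ∩ Set.Ico 0 1)) ∪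
        ((fun t => (2 : ℝ) * t) ⁻¹' ((fun t => t + (-1)) ⁻¹' (A ∩ Set.Icc 0 1))) := by
    ext t
    simp only [dbl, Set.mem_inter_iff, Set.mem_preimage, Set.mem_Icc, Set.mem_union, Set.mem_Ico]
    by_cases h : t < 1 / 2
    · simp only [h, if_true]
      constructor
      · rintro ⟨h1, h2, h3⟩
        exact Or.inl ⟨h1, by linarith, by linarith⟩
      · rintro (⟨h1, h2, h3⟩ | ⟨h1, h2, h3⟩)
        · exact ⟨h1, by linarith, by linarith⟩
        · linarith
    · simp only [h, if_false]
      constructor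
      · rintro ⟨h1, h2, h3⟩
        exact Or.inr ⟨h1, by linarith, by linarith⟩
      · rintro (⟨h1, h2, h3⟩ | ⟨h1, h2, h3⟩)
        · linarith
        · exact ⟨h1, by linarith, by linarith⟩
  have hdisj : Disjoint ((fun t => (2 : ℝ) * t) ⁻¹' (A ∩ Set.Ico 0 1))
      ((fun t => (2 : ℝ) * t) ⁻¹' ((fun t => t + (-1)) ⁻¹' (A ∩ Set.Icc 0 1))) := by
    rw [Set.disjoint_left]
    rintro t ⟨_, _, h3⟩ ⟨_, h4, _⟩
    simp only at h3 h4
    linarith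
  have hm : MeasurableSet ((fun t => (2 : ℝ) * t) ⁻¹'
      ((fun t => t + (-1)) ⁻¹' (A ∩ Set.Icc 0 1))) :=
    (measurable_const.mul measurable_id) ((measurable_id.add_const (-1))
      (hA.inter measurableSet_Icc))
  have hIco : volume (A ∩ Set.Ico (0 : ℝ) 1) = volume (A ∩ Set.Icc (0 : ℝ) 1) :=
    measure_congr ((Filter.EventuallyEq.refl _ A).inter Ico_ae_eq_Icc)
  rw [hsplit, measure_union hdisj hm, Real.volume_preimage_mul_left two_ne_zero,
    Real.volume_preimage_mul_left two_ne_zero, measure_preimage_add_right, hIco, ← add_mul,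
    ← ENNReal.ofReal_add (abs_nonneg _) (abs_nonneg _)]
  norm_num

theorem V_add_V (x : L0) :
    (V false x + V true x : L0) =ᵐ[mI] fun t => x (dbl t) := by
  have hne : ∀ᵐ t ∂mI, t ≠ 1 / 2 :=
    ae_restrict_of_ae (compl_mem_ae_iff.mpr (measure_singleton (1 / 2 : ℝ)))
  have hI : ∀ᵐ t ∂mI, t ∈ Set.Icc (0 : ℝ) 1 := ae_restrict_mem measurableSet_Icc
  filter_upwards [AEEqFun.coeFn_add (V false x) (V true x),
    AEEqFun.coeFn_mk ((half false).indicator fun t => x (stretch false t)) _,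
    AEEqFun.coeFn_mk ((half true).indicator fun t => x (stretch true t)) _, hne, hI]
    with t h h0 h1 hne hI
  rw [h, Pi.add_apply, V, V, h0, h1]
  obtain ⟨ha, hb⟩ := hI
  rcases lt_or_gt_of_ne hne with hlt | hgt
  · have hn : t ∉ half true := fun hc => by
      have := hc.1
      linarith
    have hy : t ∈ half false := ⟨ha, hlt.le⟩
    rw [Set.indicator_of_mem hy, Set.indicator_of_notMem hn, add_zero, dbl, if_pos hlt]
    simp [stretch]
  · have hn : t ∉ half false := fun hc => by
      have := hc.2
      linarith
    have hy : t ∈ half true := ⟨hgt.le, hb⟩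
    rw [Set.indicator_of_mem hy, Set.indicator_of_notMem hn, zero_add, dbl, if_neg hgt.not_gt]
    simp [stretch]

theorem equimeasurable_V_add_V (x : L0) : Equimeasurable (V false x + V true x) x := by
  intro s _
  have hA : MeasurableSet {t | s < |x t|} :=
    measurableSet_lt measurable_const x.stronglyMeasurable.measurable.abs
  rw [← mI_dbl_preimage hA]
  refine measure_congr ?_
  filter_upwards [V_add_V x] with t ht
  exact congrArg (fun r : ℝ => s < |r|) ht

theorem V_abs_le (b : Bool) (x : L0) :
    ∀ᵐ t ∂mI, |V b x t| ≤ |(V false x + V true x : L0) t| := by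
  have hne : ∀ᵐ t ∂mI, t ≠ 1 / 2 :=
    ae_restrict_of_ae (compl_mem_ae_iff.mpr (measure_singleton (1 / 2 : ℝ)))
  filter_upwards [AEEqFun.coeFn_add (V false x) (V true x),
    AEEqFun.coeFn_mk ((half false).indicator fun t => x (stretch false t)) _,
    AEEqFun.coeFn_mk ((half true).indicator fun t => x (stretch true t)) _, hne] with t h h0 h1 hne
  rw [h, Pi.add_apply]
  change V false x t = _ at h0
  change V true x t = _ at h1
  rcases lt_or_gt_of_ne hne with hlt | hgt
  · have hn : t ∉ half true := fun hc => by
      have := hc.1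
      linarith
    rw [Set.indicator_of_notMem hn] at h1
    cases b <;> simp [h1]
  · have hn : t ∉ half false := fun hc => by
      have := hc.2
      linarith
    rw [Set.indicator_of_notMem hn] at h0
    cases b <;> simp [h0]

/-- A symmetric space is invariant under `V₀` and `V₁`. -/
theorem V_mem (X : SymmetricSpace) (b : Bool) {x : L0} (hx : x ∈ X.space.carrier) :
    V b x ∈ X.space.carrier := by
  obtain ⟨hW, _⟩ := X.symmetric _ ⟨x, hx⟩ (equimeasurable_V_add_V x)
  exact (X.ideal _ ⟨_, hW⟩ (V_abs_le b x)).1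

/-- The operators `V₀` and `V₁` on a symmetric space. -/
def VOp (X : SymmetricSpace) (b : Bool) (x : X) : X := ⟨V b x, V_mem X b x.2⟩

/-- `V^α = V_{α₁} ⋯ V_{α_k}` for a multi-index `α = (α₁, …, α_k)` of zeros and ones. -/
def VMulti (X : SymmetricSpace) (α : List Bool) (x : X) : X := α.foldr (VOp X) x

/-- The block `∑_{|α| = k} ξ_α V^α f`. -/
def block (X : SymmetricSpace) (f : X) (ξ : List Bool → ℝ) (k : ℕ) : X :=
  ∑ a : Fin k → Bool, ξ (List.ofFn a) • VMulti X (List.ofFn a) f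

/-- The system `{V^α f}_{|α| ≥ k₀}` is an absolutely representing system in `X` with the
constant `C`: every `x` in `X` is the sum of a series `∑_{|α| ≥ k₀} ξ_α V^α f` converging in `X`
(unconditionally), with `∑_{k ≥ k₀} ‖∑_{|α| = k} ξ_α V^α f‖ ≤ C ‖x‖`. -/
def IsAbsRepresenting (X : SymmetricSpace) (f : X) (k₀ : ℕ) (C : ℝ) : Prop :=
  ∀ x : X, ∃ ξ : List Bool → ℝ,
    HasSum (fun α : {α : List Bool // k₀ ≤ α.length} => ξ α • VMulti X α f) x ∧
    Summable (fun j : ℕ => ‖block X f ξ (k₀ + j)‖) ∧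
    ∑' j : ℕ, ‖block X f ξ (k₀ + j)‖ ≤ C * ‖x‖

end DyadicSystem

end

namespace DyadicSystem

/-! ### Binary digits -/

/-! Under Lebesgue measure the first `k` binary digits `code k t` and the tail `dbl^[k] t` are
independent, and the tail is again uniform. A block of level `k` is the function `ξ (code k t) * f
(dbl^[k] t)`, so it is equimeasurable with `f ⊗ s`, where `s = step X ξ k` is the dyadic step
function with the same coefficients. Hence a tensor bound `D` for `f` yields `‖block X f ξ k‖ ≤ D *
‖step X ξ k‖` for all `ξ` and `k`. Conversely this estimate yields the tensor bound, because step
functions are dense in a separable symmetric space (`exists_step_near`,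
`tensorBound_of_norm_block_le`). Put `μ = ∫ f`; both implications pass through the block estimate.

From the block estimate to representation: by a law of large numbers, averages of `f ∘ dbl^[K + i *
m]` over `i < N` are close in `X` to the constant `μ` (`exists_norm_average_sub_le`). Multiplied by
a step function of lower level and divided by `μ`, they give finitely many blocks of high level
whose sum is close to that step function and whose norms add up to at most `D / |μ|` times its norm
(`exists_sum_block_near`). Successive approximation in the `ℓ¹`-sum of the block spaces makes this
exact, at the price of an arbitrarily small increase of the constant (`exists_preimage_of_approx`).

From representation to the block estimate: represent a step function of level `k` by blocks of
levels `k + j` and integrate over the dyadic intervals of level `k`. Each of its coefficients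
becomes `μ` times the sum over `j` of the coefficients of level `k + j` averaged over their last `j`
digits. Such averaging does not increase norms of blocks, so the estimate holds with `D = |μ| * C`
(`norm_block_le_of_isAbsRepresenting`). That `C` does not depend on `k` is essential here.

Separability enters through order continuity (`tendsto_cut`), which gives density of step functions
and control of the norm by the integral for uniformly bounded functions. -/

instance : MeasurableSpace (List Bool) := ⊤

instance : DiscreteMeasurableSpace (List Bool) := ⟨fun _ => trivial⟩

instance : IsProbabilityMeasure mI := ⟨by simp⟩

/-- The first binary digit. -/
noncomputable def digit (t : ℝ) : Bool := decide (1 / 2 ≤ t)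

/-- The word formed by the first `k` binary digits. -/
noncomputable def code : ℕ → ℝ → List Bool
  | 0, _ => []
  | k + 1, t => digit t :: code k (dbl t)

theorem length_code (k : ℕ) (t : ℝ) : (code k t).length = k := by
  induction k generalizing t with
  | zero => rfl
  | succ k ih => simp [code, ih]

theorem code_add (k r : ℕ) (t : ℝ) : code (k + r) t = code k t ++ code r (dbl^[k] t) := by
  induction k generalizing t with
  | zero => simp [code]
  | succ k ih =>
    rw [Nat.add_right_comm, code, ih, code, Function.iterate_succ_apply, List.cons_append]

theorem take_code {k n : ℕ} (h : k ≤ n) (t : ℝ) : (code n t).take k = code k t := by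
  obtain ⟨r, rfl⟩ := Nat.exists_eq_add_of_le h
  rw [code_add, List.take_left' (length_code k t)]

theorem measurable_digit : Measurable digit :=
  measurable_to_bool <| by
    have : digit ⁻¹' {true} = Set.Ici (1 / 2) := by ext; simp [digit]
    rw [this]; exact measurableSet_Ici

theorem measurable_code (k : ℕ) : Measurable (code k) := by
  induction k with
  | zero => exact measurable_const
  | succ k ih =>
    have h : Measurable (fun p : Bool × List Bool => p.1 :: p.2) := measurable_of_countable _
    exact h.comp (measurable_digit.prodMk (ih.comp measurable_dbl))

theorem measurable_dbl_iterate (k : ℕ) : Measurable (dbl^[k]) := measurable_dbl.iterate k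

theorem measurePreserving_dbl : MeasurePreserving dbl mI mI :=
  ⟨measurable_dbl, Measure.ext fun A hA => by
    rw [Measure.map_apply measurable_dbl hA, mI_dbl_preimage hA]⟩

theorem mI_digit_true_inter {A : Set ℝ} (hA : MeasurableSet A) :
    mI (digit ⁻¹' {true} ∩ dbl ⁻¹' A) = 2⁻¹ * mI A := by
  rw [Measure.restrict_apply ((measurable_digit (measurableSet_singleton _)).inter
    (measurable_dbl hA)), Measure.restrict_apply hA]
  have hset : digit ⁻¹' {true} ∩ dbl ⁻¹' A ∩ Set.Icc 0 1 =
      (fun t => (2 : ℝ) * t) ⁻¹' ((fun t => t + (-1)) ⁻¹' (A ∩ Set.Icc 0 1)) := by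
    ext t
    simp only [digit, Set.mem_inter_iff, Set.mem_preimage, Set.mem_singleton_iff,
      decide_eq_true_eq, Set.mem_Icc]
    constructor
    · rintro ⟨⟨h, h1⟩, h2, h3⟩
      rw [dbl, if_neg h.not_gt] at h1
      exact ⟨h1, by linarith, by linarith⟩
    · rintro ⟨h1, h2, h3⟩
      have h : 1 / 2 ≤ t := by linarith
      rw [dbl, if_neg h.not_gt]
      exact ⟨⟨h, h1⟩, by linarith, by linarith⟩
  rw [hset, Real.volume_preimage_mul_left two_ne_zero, measure_preimage_add_right,
    abs_of_pos (by norm_num), ENNReal.ofReal_inv_of_pos two_pos, ENNReal.ofReal_ofNat]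

theorem mI_digit_inter (b : Bool) {A : Set ℝ} (hA : MeasurableSet A) :
    mI (digit ⁻¹' {b} ∩ dbl ⁻¹' A) = 2⁻¹ * mI A := by
  cases b with
  | true => exact mI_digit_true_inter hA
  | false =>
    -- The other half is what remains of `mI (dbl ⁻¹' A) = mI A` after subtracting the digit-one
    -- part.
    have h := measure_inter_add_sdiff (μ := mI) (dbl ⁻¹' A)
      (measurable_digit (measurableSet_singleton true))
    rw [mI_dbl_preimage hA, Set.inter_comm, mI_digit_true_inter hA] at h
    have hset : digit ⁻¹' {false} ∩ dbl ⁻¹' A = dbl ⁻¹' A \ digit ⁻¹' {true} := by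
      ext t; simp [and_comm]
    rw [hset]
    have h2 : (2⁻¹ : ENNReal) * mI A + 2⁻¹ * mI A = mI A := by
      rw [← add_mul, ENNReal.inv_two_add_inv_two, one_mul]
    have hfin : (2⁻¹ : ENNReal) * mI A ≠ ⊤ :=
      ENNReal.mul_ne_top (by simp) (measure_ne_top _ _)
    exact (ENNReal.add_right_inj hfin).1 (h.trans h2.symm)

theorem lintegral_digit (G : Bool → ℝ → ENNReal) (hG : ∀ b, Measurable (G b)) :
    ∫⁻ t, G (digit t) (dbl t) ∂mI = 2⁻¹ * ∫⁻ t, G false t ∂mI + 2⁻¹ * ∫⁻ t, G true t ∂mI := by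
  have hb : ∀ b, ∫⁻ t in digit ⁻¹' {b}, G (digit t) (dbl t) ∂mI = 2⁻¹ * ∫⁻ t, G b t ∂mI := by
    intro b
    have hm : MeasurableSet (digit ⁻¹' {b}) := measurable_digit (measurableSet_singleton _)
    have h1 : ∫⁻ t in digit ⁻¹' {b}, G (digit t) (dbl t) ∂mI =
        ∫⁻ t in digit ⁻¹' {b}, G b (dbl t) ∂mI :=
      setLIntegral_congr_fun hm fun t ht => by rw [Set.mem_preimage.1 ht]
    have hmap : (mI.restrict (digit ⁻¹' {b})).map dbl = (2⁻¹ : ENNReal) • mI := by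
      refine Measure.ext fun A hA => ?_
      rw [Measure.map_apply measurable_dbl hA, Measure.restrict_apply (measurable_dbl hA),
        Set.inter_comm, mI_digit_inter b hA, Measure.smul_apply, smul_eq_mul]
    rw [h1, ← lintegral_map (hG b) measurable_dbl, hmap, lintegral_smul_measure, smul_eq_mul]
  rw [← lintegral_add_compl _ (measurable_digit (measurableSet_singleton false)), hb,
    ← hb true]
  congr 3
  ext t; simp

/-- Independence in integral form. Both sides depend on `t` through its first digit and `dbl t`, so
`lintegral_digit` splits each in two, and the induction hypothesis is used for `F (b :: ·)`. -/
theorem lintegral_code (k : ℕ) (F : List Bool → ℝ → ENNReal) (hF : ∀ α, Measurable (F α)) :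
    ∫⁻ t, F (code k t) (dbl^[k] t) ∂mI = ∫⁻ t, ∫⁻ s, F (code k t) s ∂mI ∂mI := by
  induction k generalizing F with
  | zero => simp [code]
  | succ k ih =>
    have h1 := lintegral_digit (fun b t => F (b :: code k t) (dbl^[k] t)) fun b => by
      have h : Measurable (fun p : List Bool × ℝ => F (b :: p.1) p.2) :=
        measurable_from_prod_countable_right fun α => hF (b :: α)
      exact h.comp ((measurable_code k).prodMk (measurable_dbl_iterate k))
    have h2 := lintegral_digit (fun b t => ∫⁻ s, F (b :: code k t) s ∂mI) fun b =>
      (measurable_of_countable fun α => ∫⁻ s, F (b :: α) s ∂mI).comp (measurable_code k)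
    simp only [code, Function.iterate_succ_apply]
    rw [h1, h2, ih _ fun α => hF _, ih _ fun α => hF _]

/-- The first `k` digits and the remaining ones are independent, and the latter have the uniform
distribution. -/
theorem measurePreserving_code (k : ℕ) :
    MeasurePreserving (fun t => (code k t, dbl^[k] t)) mI ((mI.map (code k)).prod mI) := by
  have hm : Measurable (fun t => (code k t, dbl^[k] t)) :=
    (measurable_code k).prodMk (measurable_dbl_iterate k)
  have : IsProbabilityMeasure (mI.map (code k)) :=
    Measure.isProbabilityMeasure_map (measurable_code k).aemeasurable
  refine ⟨hm, Measure.ext fun A hA => ?_⟩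
  rw [Measure.map_apply hm hA, Measure.prod_apply hA,
    lintegral_map (measurable_measure_prodMk_left hA) (measurable_code k)]
  have h := lintegral_code k (fun α s => A.indicator 1 (α, s))
    fun α => (measurable_one.indicator hA).comp measurable_prodMk_left
  have e1 : ∀ t, A.indicator (1 : List Bool × ℝ → ENNReal) (code k t, dbl^[k] t) =
    ((fun t => (code k t, dbl^[k] t)) ⁻¹' A).indicator 1 t := fun t => rfl
  have e2 : ∀ t s, A.indicator (1 : List Bool × ℝ → ENNReal) (code k t, s) =
    (Prod.mk (code k t) ⁻¹' A).indicator 1 s := fun t s => rfl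
  simp only [e1, e2] at h
  rw [lintegral_indicator_one (hm hA)] at h
  rw [h]
  exact lintegral_congr fun t => lintegral_indicator_one (measurable_prodMk_left hA)

theorem indepFun_code (k : ℕ) : ProbabilityTheory.IndepFun (code k) (dbl^[k]) mI := by
  rw [ProbabilityTheory.indepFun_iff_map_prod_eq_prod_map_map (measurable_code k).aemeasurable
    (measurable_dbl_iterate k).aemeasurable, (measurePreserving_code k).map_eq,
    (measurePreserving_dbl.iterate k).map_eq]

/-- Fubini for the pair (prefix, tail); letting the target set depend on the prefix is what the
distribution function of a block needs. -/
theorem mI_code_apply (k : ℕ) (P : List Bool → Set ℝ) (hP : ∀ α, MeasurableSet (P α)) :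
    mI {t | dbl^[k] t ∈ P (code k t)} = ∫⁻ t, mI (P (code k t)) ∂mI := by
  have hA : MeasurableSet {p : List Bool × ℝ | p.2 ∈ P p.1} := by
    have h : {p : List Bool × ℝ | p.2 ∈ P p.1} = ⋃ α, {α} ×ˢ P α := by
      ext ⟨α, s⟩; simp
    rw [h]
    exact MeasurableSet.iUnion fun α => (measurableSet_singleton α).prod (hP α)
  have h := (measurePreserving_code k).measure_preimage hA.nullMeasurableSet
  rw [Measure.prod_apply hA, lintegral_map (measurable_of_countable _) (measurable_code k)] at h
  exact h

/-- There is a measure preserving map from the interval to the square. -/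
theorem exists_measurePreserving_square :
    ∃ φ : ℝ → ℝ × ℝ, MeasurePreserving φ mI (mI.prod mI) := by
  obtain ⟨g, hg, hmap⟩ := Measure.exists_measurable_map_eq (mI.prod mI)
  -- The map `g` starts from the unit interval as a type, whereas `mI` is a measure on `ℝ`; the
  -- projection links the two.
  have hp : MeasurePreserving (Set.projIcc (0 : ℝ) 1 zero_le_one) mI
      (volume : Measure unitInterval) := by
    refine ⟨continuous_projIcc.measurable, ?_⟩
    have h := (measurePreserving_subtype_coe (μa := (volume : Measure ℝ))
      (measurableSet_Icc (a := (0 : ℝ)) (b := 1))).map_eq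
    change Measure.map Subtype.val volume = _ at h
    rw [mI, ← h, Measure.map_map continuous_projIcc.measurable measurable_subtype_coe]
    have : Set.projIcc (0 : ℝ) 1 zero_le_one ∘ Subtype.val = id := by
      ext x; simp
    rw [this, Measure.map_id]
  exact ⟨_, (⟨hg, hmap⟩ : MeasurePreserving g volume (mI.prod mI)).comp hp⟩

/-! ### The blocks as functions -/

/-- The two closed halves overlap only at the null point `1/2`, so membership in a half may be
replaced by the value of the digit. -/
theorem V_coe (b : Bool) (x : L0) :
    V b x =ᵐ[mI] fun t => if digit t = b then x (dbl t) else 0 := by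
  have hne : ∀ᵐ t ∂mI, t ≠ 1 / 2 :=
    ae_restrict_of_ae (compl_mem_ae_iff.mpr (measure_singleton (1 / 2 : ℝ)))
  filter_upwards [AEEqFun.coeFn_mk ((half b).indicator fun t => x (stretch b t)) _, hne,
    ae_restrict_mem measurableSet_Icc] with t h hne ⟨ha, hb⟩
  change V b x t = _ at h
  rw [h]
  rcases lt_or_gt_of_ne hne with hlt | hgt
  · have hd : digit t = false := by simpa [digit] using hlt
    cases b
    · rw [Set.indicator_of_mem (by exact ⟨ha, hlt.le⟩), if_pos hd, dbl, if_pos hlt]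
      rfl
    · rw [Set.indicator_of_notMem (fun hc => by have := hc.1; linarith), if_neg (by simp [hd])]
  · have hd : digit t = true := by simpa [digit] using hgt.le
    cases b
    · rw [Set.indicator_of_notMem (fun hc => by have := hc.2; linarith), if_neg (by simp [hd])]
    · rw [Set.indicator_of_mem (by exact ⟨hgt.le, hb⟩), if_pos hd, dbl, if_neg hgt.not_gt]
      rfl

theorem VMulti_coe (X : SymmetricSpace) (α : List Bool) (x : X) :
    ((VMulti X α x : X) : L0) =ᵐ[mI]
      fun t => if code α.length t = α then (x : L0) (dbl^[α.length] t) else 0 := by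
  induction α with
  | nil => exact Filter.Eventually.of_forall fun t => by simp [VMulti, code]
  | cons b α ih =>
    have h1 := V_coe b (VMulti X α x : X)
    have h2 := measurePreserving_dbl.quasiMeasurePreserving.ae ih
    filter_upwards [h1, h2] with t h1 h2
    change (V b ((VMulti X α x : X) : L0)) t = _
    rw [h1, List.length_cons, code, Function.iterate_succ_apply, h2]
    by_cases hb : digit t = b <;> simp [hb]

theorem coeFn_finset_sum {ι : Type*} (s : Finset ι) (g : ι → L0) :
    ((∑ i ∈ s, g i : L0) : ℝ → ℝ) =ᵐ[mI] fun t => ∑ i ∈ s, g i t := by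
  classical
  induction s using Finset.induction_on with
  | empty =>
    simp only [Finset.sum_empty]
    exact AEEqFun.coeFn_zero
  | insert i s hi ih =>
    filter_upwards [AEEqFun.coeFn_add (g i) (∑ i ∈ s, g i), ih] with t h1 h2
    rw [Finset.sum_insert hi, h1, Finset.sum_insert hi, Pi.add_apply, h2]

/-- The functions `V^α f` with `|α| = k` live on disjoint dyadic intervals: at `t` only the word
`code k t` contributes. -/
theorem block_coe (X : SymmetricSpace) (f : X) (ξ : List Bool → ℝ) (k : ℕ) :
    ((block X f ξ k : X) : L0) =ᵐ[mI] fun t => ξ (code k t) * (f : L0) (dbl^[k] t) := by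
  have h1 : ∀ᵐ t ∂mI, ∀ a : Fin k → Bool,
      ((ξ (List.ofFn a) • VMulti X (List.ofFn a) f : X) : L0) t =
        if code k t = List.ofFn a then ξ (List.ofFn a) * (f : L0) (dbl^[k] t) else 0 := by
    rw [ae_all_iff]
    intro a
    filter_upwards [VMulti_coe X (List.ofFn a) f,
      AEEqFun.coeFn_smul (ξ (List.ofFn a)) (VMulti X (List.ofFn a) f : L0)] with t h1 h2
    rw [Submodule.coe_smul, h2, Pi.smul_apply, h1, smul_eq_mul, List.length_ofFn]
    split_ifs <;> simp
  have h2 := coeFn_finset_sum Finset.univ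
    fun a : Fin k → Bool => ((ξ (List.ofFn a) • VMulti X (List.ofFn a) f : X) : L0)
  filter_upwards [h1, h2] with t h1 h2
  rw [block, Submodule.coe_sum, h2]
  simp only [h1]
  obtain ⟨a, ha⟩ : ∃ a : Fin k → Bool, List.ofFn a = code k t :=
    ⟨fun i => (code k t).get (i.cast (length_code k t).symm), by
      apply List.ext_get
      · simp [length_code]
      · simp⟩
  rw [Finset.sum_eq_single a]
  · rw [if_pos ha.symm, ha]
  · intro b _ hb
    rw [if_neg]
    rintro h
    exact hb (List.ofFn_injective (h.symm.trans ha.symm))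
  · simp

theorem SymmetricSpace.norm_eq (X : SymmetricSpace) {x y : X} (h : Equimeasurable x y) :
    ‖x‖ = ‖y‖ := (X.symmetric x y h).2

theorem SymmetricSpace.norm_le (X : SymmetricSpace) {x y : X}
    (h : ∀ᵐ t ∂mI, |(x : L0) t| ≤ |(y : L0) t|) : ‖x‖ ≤ ‖y‖ := (X.ideal x y h).2

theorem SymmetricSpace.ext_ae (X : SymmetricSpace) {x y : X}
    (h : (x : L0) =ᵐ[mI] (y : L0)) : x = y := Subtype.ext (AEEqFun.ext h)

/-- The constant function `1`, as an element of a symmetric space. -/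
noncomputable def SymmetricSpace.one (X : SymmetricSpace) : X := ⟨1, X.norm_one.1⟩

theorem SymmetricSpace.norm_one' (X : SymmetricSpace) : ‖X.one‖ = 1 := X.norm_one.2

theorem SymmetricSpace.one_coe (X : SymmetricSpace) : (X.one : L0) =ᵐ[mI] fun _ => (1 : ℝ) :=
  AEEqFun.coeFn_one

/-- A dyadic step function of level `k`. -/
noncomputable def step (X : SymmetricSpace) (ξ : List Bool → ℝ) (k : ℕ) : X := block X X.one ξ k

theorem step_coe (X : SymmetricSpace) (ξ : List Bool → ℝ) (k : ℕ) :
    ((step X ξ k : X) : L0) =ᵐ[mI] fun t => ξ (code k t) := by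
  filter_upwards [block_coe X X.one ξ k,
    (measurePreserving_dbl.iterate k).quasiMeasurePreserving.ae X.one_coe] with t h1 h2
  rw [step, h1, h2, mul_one]

theorem measurable_step (ξ : List Bool → ℝ) (k : ℕ) : Measurable fun t => ξ (code k t) :=
  (measurable_of_countable ξ).comp (measurable_code k)

theorem L0.measurable (x : L0) : Measurable x := x.stronglyMeasurable.measurable

theorem measurableSet_lt_abs {g : ℝ → ℝ} (hg : Measurable g) (s : ℝ) :
    MeasurableSet {t | s < |g t|} := measurableSet_lt measurable_const hg.abs

theorem measure_lt_abs_congr {Ω : Type*} [MeasurableSpace Ω] {μ : Measure Ω} {g h : Ω → ℝ}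
    (e : g =ᵐ[μ] h) (s : ℝ) : μ {t | s < |g t|} = μ {t | s < |h t|} := by
  refine measure_congr ?_
  filter_upwards [e] with t ht
  exact congrArg (fun r : ℝ => s < |r|) ht

/-- Distribution function of a block. -/
theorem mI_lt_abs_block (X : SymmetricSpace) (f : X) (ξ : List Bool → ℝ) (k : ℕ) (s : ℝ) :
    mI {t | s < |((block X f ξ k : X) : L0) t|} =
      ∫⁻ t, mI {u | s < |ξ (code k t) * (f : L0) u|} ∂mI := by
  rw [measure_lt_abs_congr (block_coe X f ξ k) s]
  exact mI_code_apply k (fun α => {u | s < |ξ α * (f : L0) u|}) fun α =>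
    measurableSet_lt_abs ((L0.measurable _).const_mul _) s

/-! ### Functions on the square -/

/-- For `t > 0` one has `s < z^⊛(t)` exactly when `t < d s`, where `d` is the distribution function.
The backward implication uses right continuity of `d`, which is continuity from below of the
measure. The level set is then an interval of length `d s`. -/
theorem mI_lt_abs_rearr (z : L0Sq) {s : ℝ} (hs : 0 < s) :
    mI {t | s < |rearr z t|} = (mI.prod mI) {p | s < |z p|} := by
  set d : ℝ → ENNReal := fun s => (mI.prod mI) {p | s < |z p|} with hd
  have hanti : Antitone d := fun a b hab => measure_mono fun p hp => lt_of_le_of_lt hab hp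
  have key : ∀ t, 0 < t → (s < rearrFun z t ↔ ENNReal.ofReal t < d s) := by
    intro t ht
    constructor
    · intro h
      by_contra hc
      exact h.not_ge (csInf_le ⟨0, fun s hs => hs.1⟩ ⟨hs.le, not_lt.1 hc⟩)
    · intro h
      have hU : {p | s < |z p|} = ⋃ n : ℕ, {p | s + 1 / ((n : ℝ) + 1) < |z p|} := by
        ext p
        simp only [Set.mem_ofPred_eq, Set.mem_iUnion]
        constructor
        · intro hp
          obtain ⟨n, hn⟩ := exists_nat_one_div_lt (sub_pos.2 hp)
          exact ⟨n, by linarith⟩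
        · rintro ⟨n, hn⟩
          have : (0 : ℝ) < 1 / ((n : ℝ) + 1) := by positivity
          linarith
      have hmono : Monotone fun n : ℕ => {p | s + 1 / ((n : ℝ) + 1) < |z p|} := by
        intro m n hmn p hp
        have : 1 / ((n : ℝ) + 1) ≤ 1 / ((m : ℝ) + 1) :=
          one_div_le_one_div_of_le (by positivity) (by exact_mod_cast Nat.succ_le_succ hmn)
        simp only [Set.mem_ofPred_eq] at hp ⊢
        linarith
      have hlim := tendsto_measure_iUnion_atTop (μ := mI.prod mI) hmono
      rw [← hU] at hlim
      obtain ⟨n, hn⟩ := (hlim.eventually (lt_mem_nhds h)).exists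
      have hpos : (0 : ℝ) < 1 / ((n : ℝ) + 1) := by positivity
      refine lt_of_lt_of_le (lt_add_of_pos_right s hpos) (le_csInf (rearr_nonempty z ht) ?_)
      intro r hr
      by_contra hc
      exact (hn.trans_le (hanti (not_le.1 hc).le)).not_ge hr.2
  have hnn : ∀ t, 0 ≤ rearrFun z t := fun t => Real.sInf_nonneg fun s hs => hs.1
  have hset : mI {t | s < |rearr z t|} = mI {t | ENNReal.ofReal t < d s} := by
    refine measure_congr ?_
    have hne : ∀ᵐ t ∂mI, t ≠ 0 :=
      ae_restrict_of_ae (compl_mem_ae_iff.mpr (measure_singleton (0 : ℝ)))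
    filter_upwards [AEEqFun.coeFn_mk (rearrFun z) (rearrFun_aestronglyMeasurable z), hne,
      ae_restrict_mem measurableSet_Icc] with t ht hne hI
    change rearr z t = _ at ht
    refine propext ?_
    change s < |rearr z t| ↔ _
    rw [ht, abs_of_nonneg (hnn t)]
    exact key t (lt_of_le_of_ne hI.1 hne.symm)
  have hd1 : d s ≤ 1 := prob_le_one
  have hdt : d s ≠ ⊤ := (hd1.trans_lt ENNReal.one_lt_top).ne
  have hle : (d s).toReal ≤ 1 := by
    rw [← ENNReal.toReal_one]
    exact ENNReal.toReal_mono ENNReal.one_ne_top hd1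
  rw [hset, Measure.restrict_apply (measurableSet_lt ENNReal.measurable_ofReal measurable_const)]
  have : {t | ENNReal.ofReal t < d s} ∩ Set.Icc 0 1 = Set.Ico 0 (d s).toReal := by
    ext t
    simp only [Set.mem_inter_iff, Set.mem_ofPred_eq, Set.mem_Icc, Set.mem_Ico]
    constructor
    · rintro ⟨h, h0, h1⟩
      exact ⟨h0, (ENNReal.ofReal_lt_iff_lt_toReal h0 hdt).1 h⟩
    · rintro ⟨h0, h⟩
      exact ⟨(ENNReal.ofReal_lt_iff_lt_toReal h0 hdt).2 h, h0, by linarith⟩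
  rw [this, Real.volume_Ico, sub_zero, ENNReal.ofReal_toReal hdt]

/-- A function on the interval with the same distribution as a function on the square decides
membership of the latter in `X(I × I)` and computes its norm. -/
theorem squareNorm_eq (X : SymmetricSpace) {z : L0Sq} {w : X}
    (h : ∀ s : ℝ, 0 < s → mI {t | s < |(w : L0) t|} = (mI.prod mI) {p | s < |z p|}) :
    ∃ hz : z ∈ squareSet X, squareNorm X ⟨z, hz⟩ = ‖w‖ :=
  X.symmetric (rearr z) w fun s hs => by rw [mI_lt_abs_rearr z hs, h s hs]

theorem tensor_coe (x y : L0) : tensor x y =ᵐ[mI.prod mI] fun p => x p.1 * y p.2 :=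
  AEEqFun.coeFn_mk _ _

theorem prod_lt_abs_tensor (x y : L0) (s : ℝ) :
    (mI.prod mI) {p | s < |tensor x y p|} = ∫⁻ t, mI {u | s < |y t * x u|} ∂mI := by
  have hm : MeasurableSet {p : ℝ × ℝ | s < |x p.1 * y p.2|} :=
    measurableSet_lt measurable_const
      (((L0.measurable x).comp measurable_fst).mul ((L0.measurable y).comp measurable_snd)).abs
  rw [measure_lt_abs_congr (tensor_coe x y) s, Measure.prod_apply_symm hm]
  refine lintegral_congr fun t => ?_
  simp only [Set.preimage_ofPred_eq, mul_comm]

/-- The bridge between the two sides of the theorem: independence of prefix and tail turns the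
product of their functions into a tensor product. -/
theorem mI_lt_abs_block_eq_tensor (X : SymmetricSpace) (f : X) (ξ : List Bool → ℝ) (k : ℕ)
    (s : ℝ) : mI {t | s < |((block X f ξ k : X) : L0) t|} =
      (mI.prod mI) {p | s < |tensor f (step X ξ k : X) p|} := by
  rw [mI_lt_abs_block, prod_lt_abs_tensor]
  refine lintegral_congr_ae ?_
  filter_upwards [step_coe X ξ k] with t ht
  rw [ht]

theorem norm_block_le_of_tensorBound (X : SymmetricSpace) {f : X} {C : ℝ}
    (h : TensorBound X f C) (ξ : List Bool → ℝ) (k : ℕ) :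
    ‖block X f ξ k‖ ≤ C * ‖step X ξ k‖ := by
  obtain ⟨h1, h2⟩ := h.2 (step X ξ k)
  obtain ⟨h3, h4⟩ := squareNorm_eq X (z := tensor f (step X ξ k : X)) (w := block X f ξ k)
    fun s _ => mI_lt_abs_block_eq_tensor X f ξ k s
  rw [← h4]
  exact h2

/-! ### Averaging over the last digit -/

/-- The average of the coefficients over the last digit. -/
noncomputable def avgLast (ξ : List Bool → ℝ) (α : List Bool) : ℝ :=
  (ξ (α ++ [false]) + ξ (α ++ [true])) / 2

/-- Change of all the digits after the `k`-th. -/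
def flipFrom (k : ℕ) (α : List Bool) : List Bool := α.take k ++ (α.drop k).map not

theorem flipFrom_append {k : ℕ} {α : List Bool} (h : α.length = k) (b : Bool) :
    flipFrom k (α ++ [b]) = α ++ [!b] := by
  simp [flipFrom, ← h]

theorem code_succ_last (k : ℕ) (t : ℝ) : code (k + 1) t = code k t ++ [digit (dbl^[k] t)] := by
  rw [code_add]
  rfl

theorem lintegral_code_succ (k : ℕ) (H : List Bool → ENNReal) :
    ∫⁻ t, H (code (k + 1) t) ∂mI =
      ∫⁻ t, (2⁻¹ * H (code k t ++ [false]) + 2⁻¹ * H (code k t ++ [true])) ∂mI := by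
  simp only [code_succ_last]
  rw [lintegral_code k (fun α s => H (α ++ [digit s])) fun α =>
    (measurable_of_countable fun b => H (α ++ [b])).comp measurable_digit]
  refine lintegral_congr fun t => ?_
  rw [lintegral_digit (fun b _ => H (code k t ++ [b])) fun b => measurable_const]
  simp

/-- Among the first `k + 1` digits only the last is changed, and it is a fair coin independent of
the others. -/
theorem map_flipFrom_code (k : ℕ) :
    mI.map (fun t => flipFrom k (code (k + 1) t)) = mI.map (code (k + 1)) := by
  have hm : Measurable (fun t => flipFrom k (code (k + 1) t)) :=
    (measurable_of_countable (flipFrom k)).comp (measurable_code _)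
  refine Measure.ext_of_lintegral _ fun H hH => ?_
  rw [lintegral_map hH hm, lintegral_map hH (measurable_code _),
    lintegral_code_succ k fun α => H (flipFrom k α), lintegral_code_succ]
  refine lintegral_congr fun t => ?_
  rw [flipFrom_append (length_code k t), flipFrom_append (length_code k t), add_comm]
  rfl

/-- Coefficients that see only `k` digits allow the block to be moved to any higher level: the tail
used changes, but not its distribution or its independence of the prefix. -/
theorem norm_block_take (X : SymmetricSpace) (f : X) (ξ : List Bool → ℝ) {k n : ℕ}
    (h : k ≤ n) : ‖block X f (fun α => ξ (α.take k)) n‖ = ‖block X f ξ k‖ := by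
  refine X.norm_eq fun s _ => ?_
  rw [mI_lt_abs_block, mI_lt_abs_block]
  simp only [take_code h]

theorem norm_block_flip (X : SymmetricSpace) (f : X) (ξ : List Bool → ℝ) (k : ℕ) :
    ‖block X f (fun α => ξ (flipFrom k α)) (k + 1)‖ = ‖block X f ξ (k + 1)‖ := by
  refine X.norm_eq fun s _ => ?_
  rw [mI_lt_abs_block, mI_lt_abs_block]
  have hm : Measurable (fun t => flipFrom k (code (k + 1) t)) :=
    (measurable_of_countable (flipFrom k)).comp (measurable_code _)
  have hH : Measurable fun α => mI {u | s < |ξ α * (f : L0) u|} := measurable_of_countable _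
  rw [← lintegral_map hH hm, map_flipFrom_code, lintegral_map hH (measurable_code _)]

theorem avgLast_take_code (ξ : List Bool → ℝ) (k : ℕ) (t : ℝ) :
    avgLast ξ ((code (k + 1) t).take k) =
      2⁻¹ * (ξ (code (k + 1) t) + ξ (flipFrom k (code (k + 1) t))) := by
  rw [take_code k.le_succ, code_succ_last, flipFrom_append (length_code k t), avgLast]
  cases digit (dbl^[k] t) <;> simp <;> ring

/-- Lifted to level `k + 1`, the averaged block is the mean of the original block and of the one
with last digit flipped, and these two have equal norms. -/
theorem norm_block_avgLast_le (X : SymmetricSpace) (f : X) (ξ : List Bool → ℝ) (k : ℕ) :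
    ‖block X f (avgLast ξ) k‖ ≤ ‖block X f ξ (k + 1)‖ := by
  have h : block X f (fun α => avgLast ξ (α.take k)) (k + 1) =
      (2⁻¹ : ℝ) • (block X f ξ (k + 1) + block X f (fun α => ξ (flipFrom k α)) (k + 1)) := by
    refine X.ext_ae ?_
    rw [Submodule.coe_smul, Submodule.coe_add]
    filter_upwards [block_coe X f (fun α => avgLast ξ (α.take k)) (k + 1),
      block_coe X f ξ (k + 1), block_coe X f (fun α => ξ (flipFrom k α)) (k + 1),
      AEEqFun.coeFn_smul (2⁻¹ : ℝ) ((block X f ξ (k + 1) : X) +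
        (block X f (fun α => ξ (flipFrom k α)) (k + 1) : X) : L0),
      AEEqFun.coeFn_add (block X f ξ (k + 1) : L0)
        (block X f (fun α => ξ (flipFrom k α)) (k + 1) : X)] with t h1 h2 h3 h4 h5
    rw [h4, h1, Pi.smul_apply, h5, Pi.add_apply, h2, h3, avgLast_take_code, smul_eq_mul]
    ring
  rw [← norm_block_take X f (avgLast ξ) k.le_succ, h, norm_smul]
  have h2 := norm_add_le (block X f ξ (k + 1)) (block X f (fun α => ξ (flipFrom k α)) (k + 1))
  rw [norm_block_flip] at h2
  rw [Real.norm_of_nonneg (by norm_num)]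
  linarith

theorem norm_block_avgLast_iterate_le (X : SymmetricSpace) (f : X) (ξ : List Bool → ℝ)
    (k r : ℕ) : ‖block X f (avgLast^[r] ξ) k‖ ≤ ‖block X f ξ (k + r)‖ := by
  induction r generalizing ξ with
  | zero => exact le_rfl
  | succ r ih => exact (ih _).trans (norm_block_avgLast_le X f ξ (k + r))

theorem exists_bound_code (ξ : List Bool → ℝ) (k : ℕ) :
    ∃ M, 0 ≤ M ∧ ∀ t, |ξ (code k t)| ≤ M := by
  obtain ⟨M, hM⟩ := ((List.finite_length_eq Bool k).image fun α => |ξ α|).bddAbove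
  have h : ∀ t, |ξ (code k t)| ≤ M := fun t =>
    hM (Set.mem_image_of_mem (fun α => |ξ α|) (length_code k t))
  exact ⟨M, (abs_nonneg _).trans (h 0), h⟩

theorem integrable_code (ξ : List Bool → ℝ) (k : ℕ) : Integrable (fun t => ξ (code k t)) mI := by
  obtain ⟨M, -, hM⟩ := exists_bound_code ξ k
  exact Integrable.of_bound (measurable_step ξ k).aestronglyMeasurable M
    (Filter.Eventually.of_forall hM)

theorem integral_code_avgLast (ξ : List Bool → ℝ) (k : ℕ) :
    ∫ t, avgLast ξ (code k t) ∂mI = ∫ t, ξ (code (k + 1) t) ∂mI := by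
  have hm : Measurable (fun t => flipFrom k (code (k + 1) t)) :=
    (measurable_of_countable (flipFrom k)).comp (measurable_code _)
  have h1 : ∫ t, ξ (flipFrom k (code (k + 1) t)) ∂mI = ∫ t, ξ (code (k + 1) t) ∂mI := by
    have hξ : ∀ μ : Measure (List Bool), AEStronglyMeasurable ξ μ := fun μ =>
      (measurable_of_countable ξ).aestronglyMeasurable
    rw [← integral_map hm.aemeasurable (hξ _), map_flipFrom_code,
      integral_map (measurable_code _).aemeasurable (hξ _)]
  have h2 : ∀ t, avgLast ξ (code k t) =
      2⁻¹ * (ξ (code (k + 1) t) + ξ (flipFrom k (code (k + 1) t))) := fun t => by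
    rw [← avgLast_take_code, take_code k.le_succ]
  simp only [h2]
  rw [integral_const_mul, integral_add (integrable_code ξ _)
    (integrable_code (fun α => ξ (flipFrom k α)) _), h1]
  ring

theorem integral_code_avgLast_iterate (ξ : List Bool → ℝ) (k r : ℕ) :
    ∫ t, (avgLast^[r] ξ) (code k t) ∂mI = ∫ t, ξ (code (k + r) t) ∂mI := by
  induction r generalizing ξ with
  | zero => rfl
  | succ r ih => exact (ih _).trans (integral_code_avgLast ξ (k + r))

theorem integral_code_eq (ξ : List Bool → ℝ) (k : ℕ) :
    ∫ t, ξ (code k t) ∂mI = (avgLast^[k] ξ) [] := by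
  have h := integral_code_avgLast_iterate ξ 0 k
  rw [zero_add] at h
  rw [← h]
  simp [code]

/-- Averaging over all digits contracts the norm and replaces `|step|` by its mean times the
constant function `1`, which has norm `1`. -/
theorem integral_abs_step_le (X : SymmetricSpace) (ξ : List Bool → ℝ) (k : ℕ) :
    ∫ t, |ξ (code k t)| ∂mI ≤ ‖step X ξ k‖ := by
  have h1 : ‖step X (fun α => |ξ α|) k‖ ≤ ‖step X ξ k‖ := by
    refine X.norm_le ?_
    filter_upwards [step_coe X (fun α => |ξ α|) k, step_coe X ξ k] with t h1 h2
    rw [h1, h2, abs_abs]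
  have h2 := norm_block_avgLast_iterate_le X X.one (fun α => |ξ α|) 0 k
  have h3 : block X X.one (avgLast^[k] fun α => |ξ α|) 0 =
      ((avgLast^[k] fun α => |ξ α|) []) • X.one := by
    simp [block, VMulti]
  rw [integral_code_eq fun α => |ξ α|]
  rw [h3, norm_smul, X.norm_one', mul_one, zero_add] at h2
  exact (le_abs_self _).trans (h2.trans h1)

theorem mI_code_preimage_pos {k : ℕ} {α : List Bool} (h : α.length = k) :
    0 < mI (code k ⁻¹' {α}) := by
  subst h
  induction α with
  | nil =>
    have : code 0 ⁻¹' {[]} = Set.univ := by ext; simp [code]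
    simp [this]
  | cons b α ih =>
    have : code (α.length + 1) ⁻¹' {b :: α} =
        digit ⁻¹' {b} ∩ dbl ⁻¹' (code α.length ⁻¹' {α}) := by
      ext; simp [code]
    rw [List.length_cons, this,
      mI_digit_inter b ((measurable_code _) (measurableSet_singleton α))]
    exact ENNReal.mul_pos (by simp) ih.ne'

theorem integral_comp_dbl_iterate (n : ℕ) {g : ℝ → ℝ} (hg : Measurable g) :
    ∫ t, g (dbl^[n] t) ∂mI = ∫ t, g t ∂mI := by
  have hmp := measurePreserving_dbl.iterate n
  conv_rhs => rw [← hmp.map_eq]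
  rw [integral_map hmp.aemeasurable hg.aestronglyMeasurable]

/-- The integral of a block over a dyadic interval. -/
theorem setIntegral_block (X : SymmetricSpace) (f : X) (ξ : List Bool → ℝ) (k r : ℕ)
    (α : List Bool) :
    ∫ t in code k ⁻¹' {α}, ((block X f ξ (k + r) : X) : L0) t ∂mI =
      mI.real (code k ⁻¹' {α}) * (avgLast^[r] ξ) α * ∫ t, (f : L0) t ∂mI := by
  have hms : MeasurableSet (code k ⁻¹' {α}) := (measurable_code k) (measurableSet_singleton α)
  -- Restriction to the dyadic interval of `α` is absorbed into the coefficients, so that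
  -- independence of prefix and tail applies to an integral over the whole interval.
  set q : List Bool → List Bool → ℝ → ℝ := fun α β x => if β.take k = α then x else 0 with hq
  have h1 : ∫ t in code k ⁻¹' {α}, ((block X f ξ (k + r) : X) : L0) t ∂mI =
      ∫ t, q α (code (k + r) t) (ξ (code (k + r) t)) * (f : L0) (dbl^[k + r] t) ∂mI := by
    rw [← integral_indicator hms]
    refine integral_congr_ae ?_
    filter_upwards [block_coe X f ξ (k + r)] with t ht
    simp only [Set.indicator, ht, hq, take_code (Nat.le_add_right k r), Set.mem_preimage,
      Set.mem_singleton_iff]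
    split_ifs <;> simp
  have hind := (indepFun_code (k + r)).comp
    (measurable_of_countable fun β => q α β (ξ β)) (L0.measurable (f : L0))
  have h2 := hind.integral_fun_mul_eq_mul_integral
    (measurable_step (fun β => q α β (ξ β)) (k + r)).aestronglyMeasurable
    ((L0.measurable (f : L0)).comp (measurable_dbl_iterate (k + r))).aestronglyMeasurable
  simp only [Function.comp_apply] at h2
  have h3 := integral_comp_dbl_iterate (k + r) (L0.measurable (f : L0))
  have h4 : ∀ (r : ℕ) (ξ : List Bool → ℝ), ∫ t, q α (code (k + r) t) (ξ (code (k + r) t)) ∂mI =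
      mI.real (code k ⁻¹' {α}) * (avgLast^[r] ξ) α := by
    intro r
    induction r with
    | zero =>
      intro ξ
      have : ∀ t, q α (code (k + 0) t) (ξ (code (k + 0) t)) =
          (code k ⁻¹' {α}).indicator (fun _ => ξ α) t := by
        intro t
        simp only [hq, add_zero, take_code le_rfl, Set.indicator, Set.mem_preimage,
          Set.mem_singleton_iff]
        split_ifs with h
        · rw [h]
        · rfl
      simp only [this]
      rw [integral_indicator_const _ hms]
      simp
    | succ r ih =>
      intro ξ
      rw [Function.iterate_succ_apply, ← ih (avgLast ξ),
        ← Nat.add_assoc, ← integral_code_avgLast (fun β => q α β (ξ β)) (k + r)]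
      refine integral_congr_ae (Filter.Eventually.of_forall fun t => ?_)
      have hl : k ≤ (code (k + r) t).length := by simp [length_code]
      simp only [avgLast, hq, List.take_append_of_le_length hl]
      -- The cutoff looks only at the first `k` digits, hence commutes with averaging over the last
      -- one.
      split_ifs <;> simp
  rw [h1, h2, h3, h4]

/-! ### Order continuity of separable symmetric spaces -/

/-- The product of an element of `X` with the indicator function of `A`. -/
noncomputable def cut (X : SymmetricSpace) (y : X) (A : Set ℝ) (hA : MeasurableSet A) : X :=
  ⟨AEEqFun.mk (A.indicator (y : L0))
    ((L0.measurable (y : L0)).indicator hA).aestronglyMeasurable,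
    (X.ideal _ y (by
      filter_upwards [AEEqFun.coeFn_mk (A.indicator (y : L0))
        ((L0.measurable (y : L0)).indicator hA).aestronglyMeasurable] with t ht
      rw [ht]
      by_cases h : t ∈ A <;> simp [h])).1⟩

theorem cut_coe (X : SymmetricSpace) (y : X) {A : Set ℝ} (hA : MeasurableSet A) :
    (cut X y A hA : L0) =ᵐ[mI] A.indicator (y : L0) := AEEqFun.coeFn_mk _ _

theorem sub_coe (X : SymmetricSpace) (x y : X) :
    ((x - y : X) : L0) =ᵐ[mI] fun t => (x : L0) t - (y : L0) t := by
  rw [Submodule.coe_sub]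
  exact AEEqFun.coeFn_sub _ _

theorem add_coe (X : SymmetricSpace) (x y : X) :
    ((x + y : X) : L0) =ᵐ[mI] fun t => (x : L0) t + (y : L0) t := by
  rw [Submodule.coe_add]
  exact AEEqFun.coeFn_add _ _

theorem smul_coe (X : SymmetricSpace) (c : ℝ) (x : X) :
    ((c • x : X) : L0) =ᵐ[mI] fun t => c * (x : L0) t := by
  rw [Submodule.coe_smul]
  exact AEEqFun.coeFn_smul _ _

theorem sum_coe (X : SymmetricSpace) {ι : Type*} (s : Finset ι) (g : ι → X) :
    ((∑ i ∈ s, g i : X) : L0) =ᵐ[mI] fun t => ∑ i ∈ s, (g i : L0) t := by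
  rw [Submodule.coe_sum]
  exact coeFn_finset_sum s fun i => (g i : L0)

theorem zero_coe (X : SymmetricSpace) : ((0 : X) : L0) =ᵐ[mI] fun _ => (0 : ℝ) :=
  AEEqFun.coeFn_zero

instance : Uncountable (Set ℕ) := ⟨fun h => by
  obtain ⟨f, hf⟩ := h.exists_injective_nat'
  exact Function.cantor_injective f hf⟩

/-- In a separable symmetric space the pieces of a function on disjoint sets cannot have norms
bounded away from zero. -/
theorem exists_norm_cut_lt (X : SymmetricSpace) [SeparableSpace X] (y : X) (D : ℕ → Set ℝ)
    (hD : ∀ i, MeasurableSet (D i)) (hdisj : Pairwise fun i j => Disjoint (D i) (D j)) {ε : ℝ}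
    (hε : 0 < ε) : ∃ i, ‖cut X y (D i) (hD i)‖ < ε := by
  by_contra! hc
  have hU : ∀ S : Set ℕ, MeasurableSet (⋃ i ∈ S, D i) := fun S =>
    MeasurableSet.biUnion S.to_countable fun i _ => hD i
  -- The unions over different `S ⊆ ℕ` would give uncountably many cuts at mutual distance at least
  -- `ε`, which separability forbids.
  set v : Set ℕ → X := fun S => cut X y (⋃ i ∈ S, D i) (hU S) with hv
  have hsep' : ∀ S T : Set ℕ, ∀ i ∈ S, i ∉ T → ε ≤ ‖v S - v T‖ := by
    intro S T i hiS hiT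
    refine (hc i).trans (X.norm_le ?_)
    filter_upwards [cut_coe X y (hD i), sub_coe X (v S) (v T), cut_coe X y (hU S),
      cut_coe X y (hU T)] with t h1 h2 h3 h4
    rw [h1, h2, h3, h4]
    by_cases ht : t ∈ D i
    · have h5 : t ∈ ⋃ i ∈ S, D i := Set.mem_biUnion hiS ht
      have h6 : t ∉ ⋃ i ∈ T, D i := by
        simp only [Set.mem_iUnion, not_exists]
        intro j hj htj
        have hij : i ≠ j := fun h => hiT (h ▸ hj)
        exact Set.disjoint_left.1 (hdisj hij) ht htj
      simp [ht, h5, h6]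
    · simp [ht]
  have hsep : ∀ S T : Set ℕ, S ≠ T → ε ≤ ‖v S - v T‖ := by
    intro S T hST
    by_cases h : S ⊆ T
    · obtain ⟨i, hi, hi'⟩ := Set.not_subset.1 fun h' => hST (h.antisymm h')
      rw [norm_sub_rev]
      exact hsep' T S i hi hi'
    · obtain ⟨i, hi, hi'⟩ := Set.not_subset.1 h
      exact hsep' S T i hi hi'
  have hpd : (Set.univ : Set (Set ℕ)).PairwiseDisjoint fun S => Metric.ball (v S) (ε / 2) := by
    intro S _ T _ hST
    refine Metric.ball_disjoint_ball ?_
    rw [dist_eq_norm, add_halves]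
    exact hsep S T hST
  exact Set.not_countable_univ (hpd.countable_of_isOpen (fun S _ => Metric.isOpen_ball)
    fun S _ => ⟨v S, Metric.mem_ball_self (half_pos hε)⟩)

/-- Order continuity of the norm. If the cuts were not Cauchy, differences along a subsequence would
be pieces of `y` on disjoint sets with norms bounded below, against `exists_norm_cut_lt`. The limit
vanishes off every `A m`, hence almost everywhere. -/
theorem tendsto_cut (X : SymmetricSpace) [SeparableSpace X] (y : X) (A : ℕ → Set ℝ)
    (hA : ∀ n, MeasurableSet (A n)) (hanti : Antitone A) (hempty : ⋂ n, A n = ∅) :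
    Filter.Tendsto (fun n => ‖cut X y (A n) (hA n)‖) Filter.atTop (nhds 0) := by
  have := X.complete
  set u : ℕ → X := fun n => cut X y (A n) (hA n) with hu
  have hcau : CauchySeq u := by
    by_contra hc
    rw [Metric.cauchySeq_iff'] at hc
    push Not at hc
    obtain ⟨ε, hε, hg⟩ := hc
    choose g hg1 hg2 using hg
    set N : ℕ → ℕ := fun i => g^[i] 0 with hN
    have hNs : ∀ i, N (i + 1) = g (N i) := fun i => Function.iterate_succ_apply' g i 0
    have hNm : Monotone N := monotone_nat_of_le_succ fun i => by rw [hNs]; exact hg1 _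
    have hDm : ∀ i, MeasurableSet (A (N i) \ A (N (i + 1))) := fun i => (hA _).diff (hA _)
    have hlt : ∀ i j, i < j → Disjoint (A (N i) \ A (N (i + 1))) (A (N j) \ A (N (j + 1))) := by
      intro i j hij
      rw [Set.disjoint_left]
      exact fun t h1 h2 => h1.2 (hanti (hNm hij) h2.1)
    obtain ⟨i, hi⟩ := exists_norm_cut_lt X y (fun i => A (N i) \ A (N (i + 1))) hDm
      (fun i j hij => by
        rcases lt_or_gt_of_ne hij with h | h
        · exact hlt i j h
        · exact (hlt j i h).symm) hε
    refine hi.not_ge ((hg2 (N i)).trans ?_)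
    rw [dist_eq_norm, ← hNs]
    refine X.norm_le ?_
    filter_upwards [sub_coe X (u (N (i + 1))) (u (N i)), cut_coe X y (hA (N (i + 1))),
      cut_coe X y (hA (N i)), cut_coe X y (hDm i)] with t h1 h2 h3 h4
    rw [h1, h2, h3, h4]
    by_cases ht : t ∈ A (N (i + 1))
    · have ht' := hanti (hNm i.le_succ) ht
      simp [ht, ht']
    · by_cases ht' : t ∈ A (N i) <;> simp [ht, ht']
  obtain ⟨w, hw⟩ := cauchySeq_tendsto_of_complete hcau
  have hwm : ∀ m, cut X w (A m)ᶜ (hA m).compl = 0 := by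
    intro m
    rw [← norm_eq_zero]
    refine le_antisymm (ge_of_tendsto (tendsto_iff_norm_sub_tendsto_zero.1 hw) ?_) (norm_nonneg _)
    filter_upwards [Filter.eventually_ge_atTop m] with n hn
    refine X.norm_le ?_
    filter_upwards [cut_coe X w (hA m).compl, sub_coe X (u n) w, cut_coe X y (hA n)]
      with t h1 h2 h3
    rw [h1, h2, h3]
    by_cases ht : t ∈ A m
    · simp [ht]
    · have ht' : t ∉ A n := fun h => ht (hanti hn h)
      simp [ht, ht']
  have hw0 : w = 0 := by
    refine X.ext_ae ?_
    have hall : ∀ᵐ t ∂mI, ∀ m, (A m)ᶜ.indicator (w : L0) t = 0 := by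
      rw [ae_all_iff]
      intro m
      have h := cut_coe X w (hA m).compl
      rw [hwm m] at h
      filter_upwards [h, zero_coe X] with t h1 h2
      rw [← h1, h2]
    filter_upwards [hall, zero_coe X] with t h1 h2
    rw [h2]
    have : t ∉ ⋂ n, A n := by simp [hempty]
    simp only [Set.mem_iInter, not_forall] at this
    obtain ⟨m, hm⟩ := this
    simpa [hm] using h1 m
  rw [hw0] at hw
  simpa using hw.norm

/-- By symmetry the norm of an indicator depends only on the measure of the set, so it suffices to
consider intervals shrinking to the left end, where `tendsto_cut` applies. -/
theorem exists_norm_cut_one_le (X : SymmetricSpace) [SeparableSpace X] {ε : ℝ} (hε : 0 < ε) :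
    ∃ δ : ℝ, 0 < δ ∧ ∀ A (hA : MeasurableSet A), mI A ≤ ENNReal.ofReal δ →
      ‖cut X X.one A hA‖ ≤ ε := by
  have hanti : Antitone fun n : ℕ => Set.Ioc (0 : ℝ) (1 / ((n : ℝ) + 1)) := by
    intro m n hmn
    exact Set.Ioc_subset_Ioc_right
      (one_div_le_one_div_of_le (by positivity) (by exact_mod_cast Nat.succ_le_succ hmn))
  have hempty : ⋂ n : ℕ, Set.Ioc (0 : ℝ) (1 / ((n : ℝ) + 1)) = ∅ := by
    ext t
    simp only [Set.mem_iInter, Set.mem_Ioc, Set.mem_empty_iff_false, iff_false]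
    intro h
    obtain ⟨n, hn⟩ := exists_nat_one_div_lt (h 0).1
    exact (h n).2.not_gt hn
  obtain ⟨n, hn⟩ := ((tendsto_cut X X.one _ (fun n => measurableSet_Ioc) hanti
    hempty).eventually (gt_mem_nhds hε)).exists
  have hpos : (0 : ℝ) < 1 / ((n : ℝ) + 1) := by positivity
  have hle1 : 1 / ((n : ℝ) + 1) ≤ 1 := by
    rw [div_le_one (by positivity)]
    linarith [(n.cast_nonneg : (0 : ℝ) ≤ n)]
  refine ⟨1 / ((n : ℝ) + 1), hpos, fun A hA hAm => ?_⟩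
  set r := (mI A).toReal with hr
  have hrle : r ≤ 1 / ((n : ℝ) + 1) := ENNReal.toReal_le_of_le_ofReal hpos.le hAm
  have hB : MeasurableSet (Set.Ioc (0 : ℝ) r) := measurableSet_Ioc
  have hBm : mI (Set.Ioc 0 r) = mI A := by
    rw [Measure.restrict_apply hB, Set.inter_eq_left.2, Real.volume_Ioc, sub_zero, hr,
      ENNReal.ofReal_toReal (measure_ne_top _ _)]
    exact fun t ht => ⟨ht.1.le, ht.2.trans (hrle.trans hle1)⟩
  have hd : ∀ (B : Set ℝ) (hB : MeasurableSet B) (s : ℝ), 0 < s →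
      mI {t | s < |(cut X X.one B hB : L0) t|} = if s < 1 then mI B else 0 := by
    intro B hB s hs
    have e : (cut X X.one B hB : L0) =ᵐ[mI] B.indicator fun _ => (1 : ℝ) := by
      filter_upwards [cut_coe X X.one hB, X.one_coe] with t h1 h2
      rw [h1]
      by_cases ht : t ∈ B <;> simp [ht, h2]
    rw [measure_lt_abs_congr e]
    have : {t | s < |B.indicator (fun _ => (1 : ℝ)) t|} = if s < 1 then B else ∅ := by
      ext t
      by_cases ht : t ∈ B <;> by_cases hs1 : s < 1 <;> simp [ht, hs1, hs.le]
    rw [this]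
    split_ifs <;> simp
  have heq : ‖cut X X.one A hA‖ = ‖cut X X.one _ hB‖ :=
    X.norm_eq fun s hs => by rw [hd A hA s hs, hd _ hB s hs, hBm]
  rw [heq]
  refine le_trans (X.norm_le ?_) hn.le
  filter_upwards [cut_coe X X.one hB,
    cut_coe X X.one (measurableSet_Ioc (a := (0 : ℝ)) (b := 1 / ((n : ℝ) + 1)))] with t h1 h2
  rw [h1, h2]
  by_cases ht : t ∈ Set.Ioc 0 r
  · rw [Set.indicator_of_mem ht, Set.indicator_of_mem (Set.Ioc_subset_Ioc_right hrle ht)]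
  · simp [Set.indicator_of_notMem ht]

/-- Uniformly bounded functions with small integrals have small norms. -/
theorem exists_norm_le_of_integral_le (X : SymmetricSpace) [SeparableSpace X] {M ε : ℝ}
    (hM : 0 ≤ M) (hε : 0 < ε) : ∃ δ : ℝ, 0 < δ ∧ ∀ z : X, (∀ᵐ t ∂mI, |(z : L0) t| ≤ M) →
      ∫ t, |(z : L0) t| ∂mI ≤ δ → ‖z‖ ≤ ε := by
  -- The bound is `|z| ≤ ε / 2 + M * χ_A` with `A = {ε / 2 ≤ |z|}`, whose measure is at most `δ` by
  -- Markov's inequality; `M + 1` in the denominator covers `M = 0`.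
  obtain ⟨δ, hδ, h⟩ := exists_norm_cut_one_le X (ε := ε / 2 / (M + 1)) (by positivity)
  refine ⟨ε / 2 * δ, by positivity, fun z hz hint => ?_⟩
  have hA : MeasurableSet {t | ε / 2 ≤ |(z : L0) t|} :=
    measurableSet_le measurable_const (L0.measurable _).abs
  have hzint : Integrable (fun t => |(z : L0) t|) mI :=
    Integrable.of_bound (L0.measurable _).abs.aestronglyMeasurable M
      (by filter_upwards [hz] with t ht; simpa using ht)
  have hmk := mul_meas_ge_le_integral_of_nonneg
    (Filter.Eventually.of_forall fun t => abs_nonneg ((z : L0) t)) hzint (ε / 2)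
  have hAm : mI {t | ε / 2 ≤ |(z : L0) t|} ≤ ENNReal.ofReal δ := by
    rw [← ofReal_measureReal]
    refine ENNReal.ofReal_le_ofReal ?_
    exact le_of_mul_le_mul_left (hmk.trans hint) (half_pos hε)
  have hle : ‖z‖ ≤ ‖(ε / 2) • X.one + M • cut X X.one _ hA‖ := by
    refine X.norm_le ?_
    filter_upwards [hz, X.one_coe, cut_coe X X.one hA, smul_coe X (ε / 2) X.one,
      smul_coe X M (cut X X.one _ hA), add_coe X ((ε / 2) • X.one) (M • cut X X.one _ hA)]
      with t h0 h1 h2 h3 h4 h5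
    rw [h5, h3, h4, h1, h2]
    by_cases ht : ε / 2 ≤ |(z : L0) t|
    · rw [Set.indicator_of_mem (by exact ht), h1]
      refine h0.trans (le_trans ?_ (le_abs_self _))
      linarith
    · rw [Set.indicator_of_notMem (by exact ht)]
      refine le_trans (not_le.1 ht).le (le_trans ?_ (le_abs_self _))
      linarith
  refine hle.trans ((norm_add_le _ _).trans ?_)
  rw [norm_smul, norm_smul, X.norm_one', Real.norm_of_nonneg (half_pos hε).le,
    Real.norm_of_nonneg hM]
  have h1 := mul_le_mul_of_nonneg_left (h _ hA hAm) hM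
  have h2 : M * (ε / 2 / (M + 1)) ≤ ε / 2 := by
    rw [mul_div_assoc', div_le_iff₀ (by positivity)]
    nlinarith
  linarith

/-! ### Density of the step functions, and the embedding into `L¹` -/

/-- The point whose first binary digits form the given word and whose other digits vanish. -/
noncomputable def point : List Bool → ℝ
  | [] => 0
  | b :: α => ((if b then 1 else 0) + point α) / 2

theorem abs_sub_point_le (k : ℕ) {t : ℝ} (ht : t ∈ Set.Icc (0 : ℝ) 1) :
    |t - point (code k t)| ≤ (1 / 2) ^ k := by
  induction k generalizing t with
  | zero => simpa [code, point, abs_of_nonneg ht.1] using ht.2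
  | succ k ih =>
    obtain ⟨h0, h1⟩ := ht
    by_cases h : t < 1 / 2
    · have hd : dbl t = 2 * t := if_pos h
      have := ih (t := dbl t) (by rw [hd]; constructor <;> linarith)
      have hdg : digit t = false := by simpa [digit] using h
      simp only [code, point, hdg, Bool.false_eq_true, if_false]
      rw [hd] at this ⊢
      rw [show t - (0 + point (code k (2 * t))) / 2 =
        (1 / 2) * (2 * t - point (code k (2 * t))) by ring, abs_mul, pow_succ']
      rw [abs_of_pos (by norm_num : (0 : ℝ) < 1 / 2)]
      linarith
    · have hd : dbl t = 2 * t - 1 := if_neg h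
      have := ih (t := dbl t) (by rw [hd]; constructor <;> linarith)
      have hdg : digit t = true := by simpa [digit] using h
      simp only [code, point, hdg, if_true]
      rw [hd] at this ⊢
      rw [show t - (1 + point (code k (2 * t - 1))) / 2 =
        (1 / 2) * (2 * t - 1 - point (code k (2 * t - 1))) by ring, abs_mul, pow_succ']
      rw [abs_of_pos (by norm_num : (0 : ℝ) < 1 / 2)]
      linarith

/-- An `L¹`-approximation by a continuous function, truncated at height `M` and sampled at the
points `point (code k t) → t`. Keeping the bound `M` makes `exists_norm_le_of_integral_le`
applicable to the error. -/
theorem exists_integral_sub_step_le {g : ℝ → ℝ} (hg : Measurable g) {M : ℝ} (hM : 0 ≤ M)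
    (hgM : ∀ᵐ t ∂mI, |g t| ≤ M) {δ : ℝ} (hδ : 0 < δ) :
    ∃ (k : ℕ) (ξ : List Bool → ℝ), (∀ α, |ξ α| ≤ M) ∧ ∫ t, |g t - ξ (code k t)| ∂mI ≤ δ := by
  have hgi : Integrable g mI := Integrable.of_bound hg.aestronglyMeasurable M hgM
  obtain ⟨h, hh, hhi⟩ := hgi.exists_boundedContinuous_integral_sub_le (half_pos hδ)
  set c : ℝ → ℝ := fun t => max (-M) (min M (h t)) with hc
  have hcc : Continuous c := by fun_prop
  have hcM : ∀ t, |c t| ≤ M := fun t =>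
    abs_le.2 ⟨le_max_left _ _, max_le (by linarith) (min_le_left _ _)⟩
  have hci : Integrable c mI := Integrable.of_bound hcc.aestronglyMeasurable M
    (Filter.Eventually.of_forall hcM)
  have hgc : ∫ t, |g t - c t| ∂mI ≤ δ / 2 := by
    refine le_trans (integral_mono_ae (hgi.sub hci).abs (hgi.sub hhi).norm ?_) hh
    filter_upwards [hgM] with t ht
    obtain ⟨h1, h2⟩ := abs_le.1 ht
    simp only [hc, Real.norm_eq_abs, Pi.sub_apply]
    rcases le_total M (h t) with h3 | h3
    · rw [min_eq_left h3, max_eq_right (by linarith)]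
      exact abs_le.2 ⟨by linarith [neg_abs_le (g t - h t)], by linarith [abs_nonneg (g t - h t)]⟩
    · rw [min_eq_right h3]
      rcases le_total (-M) (h t) with h4 | h4
      · rw [max_eq_right h4]
      · rw [max_eq_left h4]
        exact abs_le.2 ⟨by linarith [abs_nonneg (g t - h t)], by linarith [le_abs_self (g t - h t)]⟩
  have hlim : Filter.Tendsto (fun k : ℕ => ∫ t, |c t - c (point (code k t))| ∂mI) Filter.atTop
      (nhds (∫ _, (0 : ℝ) ∂mI)) := by
    refine tendsto_integral_of_dominated_convergence (fun _ => 2 * M) ?_ (integrable_const _) ?_ ?_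
    · exact fun k => (hcc.measurable.sub
        (measurable_step (fun α => c (point α)) k)).abs.aestronglyMeasurable
    · refine fun k => Filter.Eventually.of_forall fun t => ?_
      rw [Real.norm_eq_abs, abs_abs]
      linarith [abs_sub (c t) (c (point (code k t))), hcM t, hcM (point (code k t))]
    · filter_upwards [ae_restrict_mem measurableSet_Icc] with t ht
      have h1 : Filter.Tendsto (fun k => point (code k t)) Filter.atTop (nhds t) := by
        rw [tendsto_iff_norm_sub_tendsto_zero]
        refine squeeze_zero (fun _ => norm_nonneg _) (fun k => ?_)
          (tendsto_pow_atTop_nhds_zero_of_lt_one (r := (1 / 2 : ℝ)) (by norm_num) (by norm_num))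
        rw [norm_sub_rev]
        exact abs_sub_point_le k ht
      have h2 := ((hcc.tendsto t).comp h1).const_sub (c t)
      simpa using h2.abs
  rw [integral_zero] at hlim
  obtain ⟨k, hk⟩ := (hlim.eventually (gt_mem_nhds (half_pos hδ))).exists
  have hsi := integrable_code (fun α => c (point α)) k
  refine ⟨k, fun α => c (point α), fun α => hcM _, ?_⟩
  calc ∫ t, |g t - c (point (code k t))| ∂mI
      ≤ ∫ t, (|g t - c t| + |c t - c (point (code k t))|) ∂mI :=
        integral_mono (hgi.sub hsi).abs ((hgi.sub hci).abs.add (hci.sub hsi).abs)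
          fun t => abs_sub_le _ _ _
    _ = ∫ t, |g t - c t| ∂mI + ∫ t, |c t - c (point (code k t))| ∂mI :=
        integral_add (hgi.sub hci).abs (hci.sub hsi).abs
    _ ≤ δ := by linarith

theorem exists_step_near_of_bounded (X : SymmetricSpace) [SeparableSpace X] (z : X) {M : ℝ}
    (hM : 0 ≤ M) (hz : ∀ᵐ t ∂mI, |(z : L0) t| ≤ M) {ε : ℝ} (hε : 0 < ε) :
    ∃ (k : ℕ) (ξ : List Bool → ℝ), ‖z - step X ξ k‖ ≤ ε ∧
      ∫ t, |(z : L0) t - ξ (code k t)| ∂mI ≤ ε := by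
  obtain ⟨δ, hδ, h⟩ := exists_norm_le_of_integral_le X (M := 2 * M) (by linarith) hε
  obtain ⟨k, ξ, hξ, hint⟩ := exists_integral_sub_step_le (L0.measurable (z : L0)) hM hz
    (lt_min hδ hε)
  have hco : ((z - step X ξ k : X) : L0) =ᵐ[mI] fun t => (z : L0) t - ξ (code k t) := by
    filter_upwards [sub_coe X z (step X ξ k), step_coe X ξ k] with t h1 h2
    rw [h1, h2]
  refine ⟨k, ξ, h _ ?_ ?_, hint.trans (min_le_right _ _)⟩
  · filter_upwards [hco, hz] with t h1 h2
    rw [h1]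
    linarith [abs_sub ((z : L0) t) (ξ (code k t)), hξ (code k t)]
  · refine le_trans (le_of_eq (integral_congr_ae ?_)) (hint.trans (min_le_left _ _))
    filter_upwards [hco] with t h1
    rw [h1]

theorem measurableSet_abs_le (x : L0) (n : ℝ) : MeasurableSet {t | |x t| ≤ n} :=
  measurableSet_le (L0.measurable x).abs measurable_const

/-- Truncating `y` at height `n` leaves its cut to `{n < |y|}`, which is small by order continuity;
the truncation is bounded and already approximable. -/
theorem exists_step_near (X : SymmetricSpace) [SeparableSpace X] (y : X) {ε : ℝ} (hε : 0 < ε) :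
    ∃ (k : ℕ) (ξ : List Bool → ℝ), ‖y - step X ξ k‖ ≤ ε := by
  have hA : ∀ n : ℕ, MeasurableSet {t | (n : ℝ) < |(y : L0) t|} := fun n =>
    measurableSet_lt_abs (L0.measurable _) _
  have hanti : Antitone fun n : ℕ => {t | (n : ℝ) < |(y : L0) t|} := fun m n hmn t ht =>
    lt_of_le_of_lt (Nat.cast_le.2 hmn : (m : ℝ) ≤ n) ht
  have hempty : ⋂ n : ℕ, {t | (n : ℝ) < |(y : L0) t|} = ∅ := by
    ext t
    simp only [Set.mem_iInter, Set.mem_ofPred_eq, Set.mem_empty_iff_false, iff_false, not_forall,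
      not_lt]
    exact exists_nat_ge _
  obtain ⟨n, hn⟩ := ((tendsto_cut X y _ hA hanti hempty).eventually
    (gt_mem_nhds (half_pos hε))).exists
  set z := cut X y _ (measurableSet_abs_le (y : L0) n) with hz
  have h1 : y - z = cut X y _ (hA n) := by
    refine X.ext_ae ?_
    filter_upwards [sub_coe X y z, cut_coe X y (measurableSet_abs_le (y : L0) n),
      cut_coe X y (hA n)] with t h1 h2 h3
    rw [h1, h2, h3]
    by_cases ht : |(y : L0) t| ≤ n
    · simp [Set.indicator, ht, ht.not_gt]
    · simp [Set.indicator, ht, not_le.1 ht]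
  obtain ⟨k, ξ, hs, -⟩ := exists_step_near_of_bounded X z (M := n) n.cast_nonneg (by
    filter_upwards [cut_coe X y (measurableSet_abs_le (y : L0) n)] with t h
    rw [h]
    by_cases ht : |(y : L0) t| ≤ n <;> simp [Set.indicator, ht]) (half_pos hε)
  refine ⟨k, ξ, ?_⟩
  rw [show y - step X ξ k = (y - z) + (z - step X ξ k) by abel, h1]
  exact (norm_add_le _ _).trans (by linarith)

/-- The inequality is known for step functions and passes to the limit, since the approximation is
simultaneous in `X` and in `L¹`. -/
theorem integral_abs_le_of_bounded (X : SymmetricSpace) [SeparableSpace X] (z : X) {M : ℝ}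
    (hM : 0 ≤ M) (hz : ∀ᵐ t ∂mI, |(z : L0) t| ≤ M) : ∫ t, |(z : L0) t| ∂mI ≤ ‖z‖ := by
  refine le_of_forall_pos_le_add fun ε hε => ?_
  obtain ⟨k, ξ, h1, h2⟩ := exists_step_near_of_bounded X z hM hz (half_pos hε)
  have hzi : Integrable (z : L0) mI :=
    Integrable.of_bound (L0.measurable _).aestronglyMeasurable M hz
  have hsi := integrable_code ξ k
  have h3 : ∫ t, |(z : L0) t| ∂mI ≤
      ∫ t, |(z : L0) t - ξ (code k t)| ∂mI + ∫ t, |ξ (code k t)| ∂mI := by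
    have hsub : Integrable (fun t => |(z : L0) t - ξ (code k t)|) mI := (hzi.sub hsi).abs
    rw [← integral_add hsub hsi.abs]
    refine integral_mono hzi.abs (hsub.add hsi.abs) fun t => ?_
    simpa using abs_add_le ((z : L0) t - ξ (code k t)) (ξ (code k t))
  have h4 := integral_abs_step_le X ξ k
  have h5 : ‖step X ξ k‖ ≤ ‖z‖ + ‖z - step X ξ k‖ := by
    have := norm_sub_le z (z - step X ξ k)
    simpa using this
  linarith

/-- Monotone convergence along truncations. The lower integral is used because integrability of `x`
is a consequence of this bound. -/
theorem SymmetricSpace.lintegral_le (X : SymmetricSpace) [SeparableSpace X] (x : X) :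
    ∫⁻ t, ‖(x : L0) t‖ₑ ∂mI ≤ ENNReal.ofReal ‖x‖ := by
  set A : ℕ → Set ℝ := fun n => {t | |(x : L0) t| ≤ n} with hA
  have hAm : ∀ n, MeasurableSet (A n) := fun n => measurableSet_abs_le _ _
  have hmono : ∀ t, Monotone fun n => ‖(A n).indicator (x : L0) t‖ₑ := by
    intro t m n hmn
    simp only [enorm_indicator_eq_indicator_enorm]
    refine Set.indicator_le_indicator_of_subset (fun t ht => ?_) (fun _ => zero_le) t
    exact (show |(x : L0) t| ≤ m from ht).trans (Nat.cast_le.2 hmn)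
  have hlim := lintegral_tendsto_of_tendsto_of_monotone (μ := mI)
    (f := fun n t => ‖(A n).indicator (x : L0) t‖ₑ) (F := fun t => ‖(x : L0) t‖ₑ)
    (fun n => ((L0.measurable _).indicator (hAm n)).enorm.aemeasurable)
    (Filter.Eventually.of_forall hmono) (Filter.Eventually.of_forall fun t => by
      obtain ⟨N, hN⟩ := exists_nat_ge |(x : L0) t|
      refine tendsto_const_nhds.congr' ?_
      filter_upwards [Filter.eventually_ge_atTop N] with n hn
      rw [Set.indicator_of_mem]
      exact hN.trans (Nat.cast_le.2 hn))
  refine le_of_tendsto' hlim fun n => ?_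
  have hco := cut_coe X x (hAm n)
  have hb : ∀ᵐ t ∂mI, |(cut X x (A n) (hAm n) : L0) t| ≤ n := by
    filter_upwards [hco] with t h
    rw [h]
    by_cases ht : |(x : L0) t| ≤ n <;> simp [hA, Set.indicator, ht]
  have h1 := integral_abs_le_of_bounded X _ n.cast_nonneg hb
  have h2 : ‖cut X x (A n) (hAm n)‖ ≤ ‖x‖ := X.norm_le (by
    filter_upwards [hco] with t h
    rw [h]
    by_cases ht : t ∈ A n <;> simp [ht])
  have hint : Integrable (cut X x (A n) (hAm n) : L0) mI :=
    Integrable.of_bound (L0.measurable _).aestronglyMeasurable n hb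
  calc ∫⁻ t, ‖(A n).indicator (x : L0) t‖ₑ ∂mI
      = ∫⁻ t, ‖(cut X x (A n) (hAm n) : L0) t‖ₑ ∂mI := by
        refine lintegral_congr_ae ?_
        filter_upwards [hco] with t h
        rw [h]
    _ = ENNReal.ofReal (∫ t, ‖(cut X x (A n) (hAm n) : L0) t‖ ∂mI) :=
        (ofReal_integral_norm_eq_lintegral_enorm hint).symm
    _ ≤ ENNReal.ofReal ‖x‖ := ENNReal.ofReal_le_ofReal (h1.trans h2)

theorem SymmetricSpace.integrable (X : SymmetricSpace) [SeparableSpace X] (x : X) :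
    Integrable (x : L0) mI :=
  ⟨(L0.measurable _).aestronglyMeasurable, (X.lintegral_le x).trans_lt ENNReal.ofReal_lt_top⟩

/-- A separable symmetric space is contained in `L¹`. -/
theorem SymmetricSpace.integral_abs_le (X : SymmetricSpace) [SeparableSpace X] (x : X) :
    ∫ t, |(x : L0) t| ∂mI ≤ ‖x‖ := by
  have h := X.lintegral_le x
  rw [← ofReal_integral_norm_eq_lintegral_enorm (X.integrable x)] at h
  exact (ENNReal.ofReal_le_ofReal_iff (norm_nonneg x)).1 h

/-- Integration over a set, as a continuous functional. -/
noncomputable def integralOn (X : SymmetricSpace) [SeparableSpace X] (A : Set ℝ) : X →L[ℝ] ℝ :=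
  LinearMap.mkContinuous
    { toFun := fun x => ∫ t in A, (x : L0) t ∂mI
      map_add' := fun x y => by
        rw [← integral_add (X.integrable x).integrableOn (X.integrable y).integrableOn]
        exact integral_congr_ae (ae_restrict_of_ae (add_coe X x y))
      map_smul' := fun c x => by
        rw [RingHom.id_apply, smul_eq_mul, ← integral_const_mul]
        exact integral_congr_ae (ae_restrict_of_ae (smul_coe X c x)) } 1 fun x => by
    rw [one_mul]
    refine (norm_integral_le_integral_norm _).trans (le_trans ?_ (X.integral_abs_le x))
    exact setIntegral_le_integral (X.integrable x).abs
      (Filter.Eventually.of_forall fun t => abs_nonneg _)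

theorem integralOn_apply (X : SymmetricSpace) [SeparableSpace X] (A : Set ℝ) (x : X) :
    integralOn X A x = ∫ t in A, (x : L0) t ∂mI := rfl

/-! ### Ergodic averages -/

theorem memLp_code (c : List Bool → ℝ) (m : ℕ) : MemLp (fun t => c (code m t)) 2 mI := by
  obtain ⟨M, -, hM⟩ := exists_bound_code c m
  exact MemLp.of_bound (measurable_step c m).aestronglyMeasurable M
    (Filter.Eventually.of_forall hM)

theorem measurable_sum_code (c : List Bool → ℝ) (m N : ℕ) :
    Measurable fun t => ∑ i ∈ Finset.range N, c (code m (dbl^[i * m] t)) :=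
  Finset.measurable_sum _ fun _ _ => (measurable_step c m).comp (measurable_dbl_iterate _)

theorem memLp_sum_code (c : List Bool → ℝ) (m N : ℕ) :
    MemLp (fun t => ∑ i ∈ Finset.range N, c (code m (dbl^[i * m] t))) 2 mI :=
  memLp_finsetSum _ fun i _ =>
    (memLp_code c m).comp_measurePreserving (measurePreserving_dbl.iterate (i * m))

/-- The summands read consecutive disjoint windows of `m` digits. The first window is independent of
the remaining sum, which is the shorter sum composed with `dbl^[m]`. -/
theorem variance_sum_code (c : List Bool → ℝ) (m N : ℕ) :
    ProbabilityTheory.variance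
      (fun t => ∑ i ∈ Finset.range N, c (code m (dbl^[i * m] t))) mI =
      N * ProbabilityTheory.variance (fun t => c (code m t)) mI := by
  induction N with
  | zero =>
    simp only [Finset.range_zero, Finset.sum_empty, Nat.cast_zero, zero_mul]
    exact ProbabilityTheory.variance_zero mI
  | succ N ih =>
    set A : ℝ → ℝ := fun t => ∑ i ∈ Finset.range N, c (code m (dbl^[i * m] t)) with hA
    have h1 : (fun t => ∑ i ∈ Finset.range (N + 1), c (code m (dbl^[i * m] t))) =
        (fun t => c (code m t)) + A ∘ dbl^[m] := by
      funext t
      rw [Finset.sum_range_succ', add_comm]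
      simp [hA, add_mul, Function.iterate_add_apply]
    have hind : ProbabilityTheory.IndepFun (fun t => c (code m t)) (A ∘ dbl^[m]) mI :=
      (indepFun_code m).comp (measurable_of_countable c) (measurable_sum_code c m N)
    rw [h1, hind.variance_add (memLp_code c m)
      ((memLp_sum_code c m N).comp_measurePreserving (measurePreserving_dbl.iterate m))]
    have h2 := (measurePreserving_dbl.iterate m).variance_fun_comp
      (f := A) (measurable_sum_code c m N).aemeasurable
    rw [show A ∘ dbl^[m] = fun t => A (dbl^[m] t) from rfl, h2, ih]
    push_cast
    ring

theorem integral_sum_code (c : List Bool → ℝ) (m N : ℕ) :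
    ∫ t, ∑ i ∈ Finset.range N, c (code m (dbl^[i * m] t)) ∂mI = N * ∫ t, c (code m t) ∂mI := by
  have h : ∀ i ∈ Finset.range N, Integrable (fun t => c (code m (dbl^[i * m] t))) mI :=
    fun i _ => ((memLp_code c m).comp_measurePreserving
      (measurePreserving_dbl.iterate (i * m))).integrable one_le_two
  rw [integral_finsetSum _ h]
  simp [integral_comp_dbl_iterate _ (measurable_step c m)]

theorem integral_abs_sub_sq_le {g : ℝ → ℝ} (hg : MemLp g 2 mI) :
    (∫ t, |g t - ∫ u, g u ∂mI| ∂mI) ^ 2 ≤ ProbabilityTheory.variance g mI := by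
  have hL : MemLp (fun t => |g t - ∫ u, g u ∂mI|) 2 mI := (hg.sub (memLp_const _)).abs
  -- Nonnegativity of the variance of `|g - ∫ g|` is the Cauchy–Schwarz inequality wanted here.
  have h := ProbabilityTheory.variance_nonneg (fun t => |g t - ∫ u, g u ∂mI|) mI
  rw [ProbabilityTheory.variance_eq_sub hL] at h
  rw [ProbabilityTheory.variance_eq_integral hg.aestronglyMeasurable.aemeasurable]
  simp only [Pi.pow_apply, sq_abs] at h
  linarith

/-- The averages of a step function along the doubling map converge to its integral. -/
theorem exists_integral_abs_average_le (c : List Bool → ℝ) (m : ℕ) {δ : ℝ} (hδ : 0 < δ) :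
    ∃ N : ℕ, 0 < N ∧ ∫ t, |(N : ℝ)⁻¹ * ∑ i ∈ Finset.range N, c (code m (dbl^[i * m] t)) -
      ∫ u, c (code m u) ∂mI| ∂mI ≤ δ := by
  set v := ProbabilityTheory.variance (fun t => c (code m t)) mI with hv
  have hv0 : 0 ≤ v := ProbabilityTheory.variance_nonneg _ _
  -- The centred sum has variance `N * v`, so its `L¹` norm is at most `√(N * v)`; this choice makes
  -- it at most `N * δ`.
  obtain ⟨N, hN⟩ := exists_nat_gt (v / δ ^ 2)
  have hN0 : (0 : ℝ) < N := lt_of_le_of_lt (by positivity) hN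
  refine ⟨N, Nat.cast_pos.1 hN0, ?_⟩
  have h := integral_abs_sub_sq_le (memLp_sum_code c m N)
  rw [variance_sum_code, integral_sum_code, ← hv] at h
  have h2 : ∀ t, |(N : ℝ)⁻¹ * ∑ i ∈ Finset.range N, c (code m (dbl^[i * m] t)) -
      ∫ u, c (code m u) ∂mI| = (N : ℝ)⁻¹ *
      |∑ i ∈ Finset.range N, c (code m (dbl^[i * m] t)) - N * ∫ u, c (code m u) ∂mI| := by
    intro t
    rw [← abs_of_pos (inv_pos.2 hN0), ← abs_mul, abs_of_pos (inv_pos.2 hN0), mul_sub,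
      inv_mul_cancel_left₀ hN0.ne']
  simp only [h2]
  rw [integral_const_mul, inv_mul_le_iff₀ hN0]
  refine le_of_sq_le_sq (h.trans ?_) (by positivity)
  rw [div_lt_iff₀ (by positivity)] at hN
  nlinarith

/-! ### Approximation of an element of `X` by blocks of high levels. -/

theorem block_sub (X : SymmetricSpace) (f g : X) (ξ : List Bool → ℝ) (k : ℕ) :
    block X (f - g) ξ k = block X f ξ k - block X g ξ k := by
  refine X.ext_ae ?_
  filter_upwards [block_coe X (f - g) ξ k, sub_coe X (block X f ξ k) (block X g ξ k),
    block_coe X f ξ k, block_coe X g ξ k,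
    (measurePreserving_dbl.iterate k).quasiMeasurePreserving.ae (sub_coe X f g)]
    with t h1 h2 h3 h4 h5
  rw [h1, h2, h3, h4, h5, mul_sub]

theorem norm_block_one (X : SymmetricSpace) (f : X) (k : ℕ) :
    ‖block X f (fun _ => 1) k‖ = ‖f‖ := by
  rw [norm_block_take X f (fun _ => 1) k.zero_le]
  simp [block, VMulti]

/-- A mean ergodic theorem in `X`. Replacing `f` by a step function `s` of level `m` costs at most
`ε / 3`, because blocks with unit coefficients preserve the norm. The averages of `s` are uniformly
bounded, so their `L¹` convergence gives convergence in `X`. The choice of `N` and `m` is uniform in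
`K` since `dbl^[K]` preserves measure. -/
theorem exists_norm_average_sub_le (X : SymmetricSpace) [SeparableSpace X] (f : X) {ε : ℝ}
    (hε : 0 < ε) : ∃ N m : ℕ, 0 < N ∧ ∀ K : ℕ,
      ‖(N : ℝ)⁻¹ • ∑ i ∈ Finset.range N, block X f (fun _ => 1) (K + i * m) -
        (∫ t, (f : L0) t ∂mI) • X.one‖ ≤ ε := by
  have hε3 : 0 < ε / 3 := by positivity
  obtain ⟨m, ξ, hs⟩ := exists_step_near X f hε3
  set s := step X ξ m with hsdef
  obtain ⟨M, hM0, hM⟩ := exists_bound_code ξ m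
  obtain ⟨δ, hδ, hsmall⟩ := exists_norm_le_of_integral_le X (M := 2 * M) (by linarith) hε3
  obtain ⟨N, hN, hint⟩ := exists_integral_abs_average_le ξ m hδ
  have hN0 : (0 : ℝ) < N := Nat.cast_pos.2 hN
  refine ⟨N, m, hN, fun K => ?_⟩
  set a := ∫ u, ξ (code m u) ∂mI with ha
  have haM : |a| ≤ M := by
    refine (abs_integral_le_integral_abs).trans ?_
    calc ∫ u, |ξ (code m u)| ∂mI ≤ ∫ _, M ∂mI :=
          integral_mono (integrable_code ξ m).abs (integrable_const _) hM
      _ = M := by simp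
  have hsa : ∫ t, (s : L0) t ∂mI = a := integral_congr_ae (step_coe X ξ m)
  have hμa : |(∫ t, (f : L0) t ∂mI) - a| ≤ ε / 3 := by
    rw [← hsa, ← integral_sub (X.integrable f) (X.integrable s)]
    refine (abs_integral_le_integral_abs).trans (le_trans ?_ ((X.integral_abs_le (f - s)).trans hs))
    refine le_of_eq (integral_congr_ae ?_)
    filter_upwards [sub_coe X f s] with t h
    rw [h]
  set uf := (N : ℝ)⁻¹ • ∑ i ∈ Finset.range N, block X f (fun _ => 1) (K + i * m) with huf
  set us := (N : ℝ)⁻¹ • ∑ i ∈ Finset.range N, block X s (fun _ => 1) (K + i * m) with hus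
  have h1 : ‖uf - us‖ ≤ ε / 3 := by
    rw [huf, hus, ← smul_sub, ← Finset.sum_sub_distrib]
    simp only [← block_sub]
    rw [norm_smul, Real.norm_of_nonneg (inv_pos.2 hN0).le, inv_mul_le_iff₀ hN0]
    refine (norm_sum_le _ _).trans ?_
    simp only [norm_block_one, Finset.sum_const, Finset.card_range, nsmul_eq_mul]
    exact mul_le_mul_of_nonneg_left hs hN0.le
  have hco : ((us - a • X.one : X) : L0) =ᵐ[mI] fun t =>
      (N : ℝ)⁻¹ * ∑ i ∈ Finset.range N, ξ (code m (dbl^[i * m] (dbl^[K] t))) - a := by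
    have hb : ∀ᵐ t ∂mI, ∀ i, ((block X s (fun _ => 1) (K + i * m) : X) : L0) t =
        ξ (code m (dbl^[i * m] (dbl^[K] t))) := by
      rw [ae_all_iff]
      intro i
      filter_upwards [block_coe X s (fun _ => 1) (K + i * m),
        (measurePreserving_dbl.iterate (K + i * m)).quasiMeasurePreserving.ae (step_coe X ξ m)]
        with t h1 h2
      rw [h1, hsdef, h2, one_mul, add_comm K, Function.iterate_add_apply]
    filter_upwards [sub_coe X us (a • X.one), smul_coe X a X.one, X.one_coe,
      smul_coe X (N : ℝ)⁻¹ (∑ i ∈ Finset.range N, block X s (fun _ => 1) (K + i * m)),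
      sum_coe X (Finset.range N) fun i => block X s (fun _ => 1) (K + i * m), hb]
      with t h1 h2 h3 h4 h5 h6
    rw [h1, h2, h3, hus, h4, h5]
    simp only [h6, mul_one]
  have hmA : Measurable fun t =>
      |(N : ℝ)⁻¹ * ∑ i ∈ Finset.range N, ξ (code m (dbl^[i * m] t)) - a| :=
    (((measurable_sum_code ξ m N).const_mul _).sub_const a).abs
  have h2 : ‖us - a • X.one‖ ≤ ε / 3 := by
    refine hsmall _ ?_ ?_
    · filter_upwards [hco] with t h
      rw [h]
      have hsum : |∑ i ∈ Finset.range N, ξ (code m (dbl^[i * m] (dbl^[K] t)))| ≤ N * M := by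
        refine (Finset.abs_sum_le_sum_abs _ _).trans ?_
        refine (Finset.sum_le_sum fun i _ => hM _).trans ?_
        simp
      have h3 : |(N : ℝ)⁻¹ * ∑ i ∈ Finset.range N, ξ (code m (dbl^[i * m] (dbl^[K] t)))| ≤ M := by
        rw [abs_mul, abs_of_pos (inv_pos.2 hN0), inv_mul_le_iff₀ hN0]
        exact hsum
      exact (abs_sub _ _).trans (by linarith)
    · refine le_trans (le_of_eq ?_) hint
      rw [← integral_comp_dbl_iterate K hmA]
      refine integral_congr_ae ?_
      filter_upwards [hco] with t h
      rw [h]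
  have h3 : ‖(a - ∫ t, (f : L0) t ∂mI) • X.one‖ ≤ ε / 3 := by
    rw [norm_smul, X.norm_one', mul_one, Real.norm_eq_abs, abs_sub_comm]
    exact hμa
  have h4 : uf - (∫ t, (f : L0) t ∂mI) • X.one =
      (uf - us) + (us - a • X.one) + (a - ∫ t, (f : L0) t ∂mI) • X.one := by
    rw [sub_smul]
    abel
  rw [h4]
  refine (norm_add_le _ _).trans ?_
  linarith [norm_add_le (uf - us) (us - a • X.one)]

theorem block_smul_coeff (X : SymmetricSpace) (f : X) (c : ℝ) (ξ : List Bool → ℝ) (k : ℕ) :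
    block X f (fun α => c * ξ α) k = c • block X f ξ k := by
  simp [block, Finset.smul_sum, mul_smul]

/-- Finitely many blocks of high levels approximate a given element. -/
theorem exists_sum_block_near (X : SymmetricSpace) [SeparableSpace X] (f : X)
    (hf : ∫ t, (f : L0) t ∂mI ≠ 0) {D : ℝ} (hD0 : 0 ≤ D)
    (hD : ∀ ξ k, ‖block X f ξ k‖ ≤ D * ‖step X ξ k‖) (k₀ : ℕ) (x : X) {ε : ℝ} (hε : 0 < ε) :
    ∃ (N : ℕ) (j : ℕ → ℕ) (ξ : List Bool → ℝ),
      ‖x - ∑ i ∈ Finset.range N, block X f ξ (k₀ + j i)‖ ≤ ε ∧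
      ∑ i ∈ Finset.range N, ‖block X f ξ (k₀ + j i)‖ ≤
        D / |∫ t, (f : L0) t ∂mI| * ‖x‖ + ε := by
  set μ := ∫ t, (f : L0) t ∂mI with hμ
  have hμ0 : 0 < |μ| := abs_pos.2 hf
  set D' := D / |μ| with hD'
  have hD'0 : 0 ≤ D' := by positivity
  -- The first tolerance is half of the approximation error; the second gives `D' * ‖step X c k‖ ≤
  -- D' * ‖x‖ + ε`.
  obtain ⟨k, c, hc⟩ := exists_step_near X x (ε := min (ε / 2) (ε / (D' + 1))) (by positivity)
  obtain ⟨M, hM0, hM⟩ := exists_bound_code c k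
  -- The tolerance must remain at most `ε / 2` after multiplication by `|c| ≤ M` and division by
  -- `|μ|`.
  obtain ⟨N, m, hN, hav⟩ := exists_norm_average_sub_le X f
    (ε := |μ| * (ε / 2) / (M + 1)) (by positivity)
  have hN0 : (0 : ℝ) < N := Nat.cast_pos.2 hN
  set b : List Bool → ℝ := fun α => c (α.take k) with hb
  -- The offset `k` makes every level at least `k`, so all blocks carry the same factor `c (code k
  -- t)`, and the error is this factor times the error of the ergodic average.
  refine ⟨N, fun i => k + i * m, fun α => ((N : ℝ) * μ)⁻¹ * b α, ?_, ?_⟩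
  · simp only [block_smul_coeff]
    rw [← Finset.smul_sum]
    set B := ∑ i ∈ Finset.range N, block X f b (k₀ + (k + i * m)) with hB
    have hK := hav (k₀ + k)
    set u := (N : ℝ)⁻¹ • ∑ i ∈ Finset.range N, block X f (fun _ => 1) (k₀ + k + i * m) -
      μ • X.one with hu
    have h1 : ‖(N : ℝ)⁻¹ • B - μ • step X c k‖ ≤ ‖M • u‖ := by
      refine X.norm_le ?_
      have hb1 : ∀ᵐ t ∂mI, ∀ i, ((block X f b (k₀ + (k + i * m)) : X) : L0) t =
          c (code k t) * (f : L0) (dbl^[k₀ + k + i * m] t) := by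
        rw [ae_all_iff]
        intro i
        filter_upwards [block_coe X f b (k₀ + (k + i * m))] with t h1
        rw [h1, hb]
        simp only [take_code (show k ≤ k₀ + (k + i * m) by omega), add_assoc]
      have hb2 : ∀ᵐ t ∂mI, ∀ i, ((block X f (fun _ => 1) (k₀ + k + i * m) : X) : L0) t =
          (f : L0) (dbl^[k₀ + k + i * m] t) := by
        rw [ae_all_iff]
        intro i
        filter_upwards [block_coe X f (fun _ => 1) (k₀ + k + i * m)] with t h1
        rw [h1, one_mul]
      filter_upwards [hb1, hb2, sub_coe X ((N : ℝ)⁻¹ • B) (μ • step X c k),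
        smul_coe X (N : ℝ)⁻¹ B, smul_coe X μ (step X c k), step_coe X c k,
        sum_coe X (Finset.range N) fun i => block X f b (k₀ + (k + i * m)), smul_coe X M u,
        sub_coe X ((N : ℝ)⁻¹ • ∑ i ∈ Finset.range N, block X f (fun _ => 1) (k₀ + k + i * m))
          (μ • X.one), smul_coe X μ X.one, X.one_coe,
        smul_coe X (N : ℝ)⁻¹ (∑ i ∈ Finset.range N, block X f (fun _ => 1) (k₀ + k + i * m)),
        sum_coe X (Finset.range N) fun i => block X f (fun _ => 1) (k₀ + k + i * m)]
        with t e1 e2 e3 e4 e5 e6 e7 e8 e9 e10 e11 e12 e13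
      rw [e3, e4, e5, e6, hB, e7, e8, hu, e9, e10, e11, e12, e13]
      simp only [e1, e2]
      rw [← Finset.mul_sum, show ∀ p : ℝ, (N : ℝ)⁻¹ * (c (code k t) * p) - μ * c (code k t) =
        c (code k t) * ((N : ℝ)⁻¹ * p - μ * 1) from fun p => by ring, abs_mul, abs_mul]
      exact mul_le_mul_of_nonneg_right ((hM t).trans (le_abs_self M)) (abs_nonneg _)
    have h2 : ‖step X c k - ((N : ℝ) * μ)⁻¹ • B‖ ≤ ε / 2 := by
      have e : step X c k - ((N : ℝ) * μ)⁻¹ • B =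
          (-μ⁻¹) • ((N : ℝ)⁻¹ • B - μ • step X c k) := by
        rw [smul_sub, smul_smul, smul_smul, neg_mul, neg_mul, inv_mul_cancel₀ hf, mul_inv,
          mul_comm μ⁻¹]
        module
      rw [e, norm_smul, norm_neg, norm_inv, Real.norm_eq_abs, inv_mul_le_iff₀ hμ0]
      refine h1.trans ?_
      rw [norm_smul, Real.norm_of_nonneg hM0]
      refine (mul_le_mul_of_nonneg_left hK hM0).trans ?_
      rw [mul_div_assoc', div_le_iff₀ (by positivity)]
      nlinarith [mul_pos hμ0 (half_pos hε)]
    have e : x - ((N : ℝ) * μ)⁻¹ • B = (x - step X c k) + (step X c k - ((N : ℝ) * μ)⁻¹ • B) := by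
      abel
    rw [e]
    refine (norm_add_le _ _).trans ?_
    linarith [hc.trans (min_le_left _ _)]
  · have h1 : ∀ i, ‖block X f (fun α => ((N : ℝ) * μ)⁻¹ * b α) (k₀ + (k + i * m))‖ ≤
        (N : ℝ)⁻¹ * (D' * ‖step X c k‖) := by
      intro i
      rw [block_smul_coeff, norm_smul, hb, norm_block_take X f c (by omega), norm_inv, norm_mul,
        Real.norm_eq_abs, Real.norm_eq_abs, abs_of_pos hN0, mul_inv, mul_assoc]
      refine mul_le_mul_of_nonneg_left ?_ (inv_pos.2 hN0).le
      rw [hD', div_mul_eq_mul_div, inv_mul_eq_div]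
      exact div_le_div_of_nonneg_right (hD c k) hμ0.le
    refine (Finset.sum_le_sum fun i _ => h1 i).trans ?_
    rw [Finset.sum_const, Finset.card_range, nsmul_eq_mul, mul_inv_cancel_left₀ hN0.ne']
    have h2 : ‖step X c k‖ ≤ ‖x‖ + ε / (D' + 1) := by
      have h3 := norm_sub_le x (x - step X c k)
      rw [sub_sub_cancel] at h3
      linarith [hc.trans (min_le_right _ _)]
    refine (mul_le_mul_of_nonneg_left h2 hD'0).trans ?_
    rw [mul_add]
    have h4 : D' * (ε / (D' + 1)) ≤ ε := by
      rw [mul_div_assoc', div_le_iff₀ (by positivity)]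
      nlinarith
    linarith

/-! ### Absolutely representing systems from approximation by blocks -/

/-- An operator with approximate preimages under norm control has exact preimages. -/
theorem exists_preimage_of_approx {Y Z : Type*} [NormedAddCommGroup Y] [NormedSpace ℝ Y]
    [CompleteSpace Y] [NormedAddCommGroup Z] [NormedSpace ℝ Z] (S : Y →L[ℝ] Z) {D : ℝ}
    (hD : 0 ≤ D) (h : ∀ (x : Z) (ε : ℝ), 0 < ε → ∃ u, ‖x - S u‖ ≤ ε ∧ ‖u‖ ≤ D * ‖x‖ + ε)
    (x : Z) {C : ℝ} (hC : D < C) : ∃ u, S u = x ∧ ‖u‖ ≤ C * ‖x‖ := by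
  rcases eq_or_ne x 0 with rfl | hx
  · exact ⟨0, by simp, by simp⟩
  have hx0 : 0 < ‖x‖ := norm_pos_iff.2 hx
  choose! T hT1 hT2 using h
  -- The first term costs `D * ‖x‖ + η` and the later ones at most `(D + 1) * (η * 2)`; the excess
  -- over `D * ‖x‖` is `(2 * D + 3) * η`.
  set η := (C - D) * ‖x‖ / (2 * D + 3) with hη
  have hη0 : 0 < η := div_pos (mul_pos (sub_pos.2 hC) hx0) (by linarith)
  set e : ℕ → ℝ := fun n => η * (1 / 2) ^ n with he
  have he0 : ∀ n, 0 < e n := fun n => by positivity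
  -- The residual after `n` corrections; each correction is an approximate preimage of the current
  -- residual.
  let r : ℕ → Z := fun n => Nat.rec x (fun n y => y - S (T y (e n))) n
  set u : ℕ → Y := fun n => T (r n) (e n) with hu
  have hr : ∀ n, r (n + 1) = r n - S (u n) := fun n => rfl
  have hrn : ∀ n, ‖r (n + 1)‖ ≤ e n := fun n => hT1 (r n) (e n) (he0 n)
  have hun : ∀ n, ‖u (n + 1)‖ ≤ (D + 1) * e n := by
    intro n
    have h1 := hT2 (r (n + 1)) (e (n + 1)) (he0 _)
    have h2 := mul_le_mul_of_nonneg_left (hrn n) hD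
    have h3 : e (n + 1) ≤ e n := by
      have : e (n + 1) = e n * (1 / 2) := by simp only [he, pow_succ, mul_assoc]
      linarith [he0 n]
    refine h1.trans ?_
    linarith
  have hge : HasSum (fun n => (D + 1) * e n) ((D + 1) * (η * 2)) :=
    (hasSum_geometric_two.mul_left η).mul_left (D + 1)
  have hsn' : Summable fun n => ‖u (n + 1)‖ :=
    Summable.of_nonneg_of_le (fun _ => norm_nonneg _) hun hge.summable
  have hsn : Summable fun n => ‖u n‖ := (summable_nat_add_iff 1).1 hsn'
  have hsum : ‖∑' n, u n‖ ≤ C * ‖x‖ := by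
    refine (norm_tsum_le_tsum_norm hsn).trans ?_
    rw [hsn.tsum_eq_zero_add]
    have h1 : ‖u 0‖ ≤ D * ‖x‖ + η := by
      have h0 : e 0 = η := by simp [he]
      exact h0 ▸ hT2 x (e 0) (he0 0)
    have h2 : ∑' n, ‖u (n + 1)‖ ≤ (D + 1) * (η * 2) :=
      (hsn'.tsum_le_tsum hun hge.summable).trans_eq hge.tsum_eq
    have h3 : η * (2 * D + 3) = (C - D) * ‖x‖ := div_mul_cancel₀ _ (by linarith)
    linarith
  refine ⟨∑' n, u n, ?_, hsum⟩
  have hS : HasSum (fun n => S (u n)) (S (∑' n, u n)) := S.hasSum hsn.of_norm.hasSum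
  have hpart : ∀ n, ∑ i ∈ Finset.range n, S (u i) = x - r n := by
    intro n
    induction n with
    | zero => simp [r]
    | succ n ih =>
      rw [Finset.sum_range_succ, ih, hr]
      abel
  have he_lim : Filter.Tendsto e Filter.atTop (nhds 0) := by
    have h := (tendsto_pow_atTop_nhds_zero_of_lt_one (r := (1 / 2 : ℝ)) (by norm_num)
      (by norm_num)).const_mul η
    rwa [mul_zero] at h
  have hr0 : Filter.Tendsto r Filter.atTop (nhds 0) :=
    (Filter.tendsto_add_atTop_iff_nat 1).1 (squeeze_zero_norm hrn he_lim)
  have h1 := hS.tendsto_sum_nat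
  simp only [hpart] at h1
  have h2 := hr0.const_sub x
  rw [sub_zero] at h2
  exact tendsto_nhds_unique h1 h2

/-- The words of length at least `k₀`, sorted by their lengths. -/
noncomputable def wordEquiv (k₀ : ℕ) :
    (Σ j : ℕ, Fin (k₀ + j) → Bool) ≃ {α : List Bool // k₀ ≤ α.length} :=
  Equiv.ofBijective (fun p => ⟨List.ofFn p.2, by simp⟩) <| by
    constructor
    · rintro ⟨i, a⟩ ⟨j, b⟩ h
      have h1 : List.ofFn a = List.ofFn b := congrArg Subtype.val h
      have h2 : i = j := by
        have := congrArg List.length h1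
        simpa using this
      subst h2
      rw [List.ofFn_injective h1]
    · rintro ⟨α, hα⟩
      obtain ⟨j, hj⟩ := Nat.exists_eq_add_of_le hα
      refine ⟨⟨j, fun i => α.get (i.cast hj.symm)⟩, Subtype.ext ?_⟩
      apply List.ext_get
      · simp [hj]
      · simp

/-- Omitting words sets coefficients to zero, and disjointness of the supports makes this decrease
the modulus pointwise. This is the source of unconditional convergence. -/
theorem norm_sum_le_norm_block (X : SymmetricSpace) (f : X) (ξ : List Bool → ℝ) (k : ℕ)
    (s : Finset (Fin k → Bool)) :
    ‖∑ a ∈ s, ξ (List.ofFn a) • VMulti X (List.ofFn a) f‖ ≤ ‖block X f ξ k‖ := by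
  classical
  set ξ' : List Bool → ℝ := fun α => if ∃ a ∈ s, List.ofFn a = α then ξ α else 0 with hξ'
  have h : ∑ a ∈ s, ξ (List.ofFn a) • VMulti X (List.ofFn a) f = block X f ξ' k := by
    rw [block, ← Finset.sum_filter_add_sum_filter_not Finset.univ (· ∈ s),
      Finset.sum_eq_zero (s := Finset.univ.filter (· ∉ s)), add_zero]
    · rw [Finset.filter_mem_eq_inter, Finset.univ_inter]
      refine Finset.sum_congr rfl fun a ha => ?_
      rw [hξ']
      simp only
      rw [if_pos ⟨a, ha, rfl⟩]
    · intro a ha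
      have hn : ¬ ∃ b ∈ s, List.ofFn b = List.ofFn a := by
        rintro ⟨b, hb, hba⟩
        exact (Finset.mem_filter.1 ha).2 (List.ofFn_injective hba ▸ hb)
      rw [hξ']
      simp only
      rw [if_neg hn, zero_smul]
  rw [h]
  refine X.norm_le ?_
  filter_upwards [block_coe X f ξ' k, block_coe X f ξ k] with t h1 h2
  rw [h1, h2, abs_mul, abs_mul]
  refine mul_le_mul_of_nonneg_right ?_ (abs_nonneg _)
  simp only [hξ']
  split_ifs <;> simp

/-- An absolutely convergent series of blocks converges unconditionally as a series over words. -/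
theorem hasSum_words (X : SymmetricSpace) (f : X) (ξ : List Bool → ℝ) (k₀ : ℕ) {x : X}
    (hs : Summable fun j => ‖block X f ξ (k₀ + j)‖)
    (hx : HasSum (fun j => block X f ξ (k₀ + j)) x) :
    HasSum (fun α : {α : List Bool // k₀ ≤ α.length} => ξ α • VMulti X α f) x := by
  classical
  have := X.complete
  rw [← (wordEquiv k₀).hasSum_iff]
  set F : (Σ j : ℕ, Fin (k₀ + j) → Bool) → X :=
    fun p => ξ (List.ofFn p.2) • VMulti X (List.ofFn p.2) f with hF
  change HasSum F x
  have hsum : Summable F := by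
    rw [summable_iff_vanishing_norm]
    intro ε hε
    obtain ⟨s, hs⟩ := summable_iff_vanishing_norm.1 hs ε hε
    refine ⟨s.sigma fun _ => Finset.univ, fun t ht => ?_⟩
    -- A finite set of words is sorted by length; each level contributes a subsum bounded by the
    -- norm of the full block.
    have hts : t = (t.image Sigma.fst).sigma
        fun j => Finset.univ.filter fun a => (⟨j, a⟩ : Σ j : ℕ, Fin (k₀ + j) → Bool) ∈ t := by
      ext ⟨j, a⟩
      simp only [Finset.mem_sigma, Finset.mem_image, Finset.mem_filter, Finset.mem_univ, true_and]
      exact ⟨fun h => ⟨⟨_, h, rfl⟩, h⟩, fun h => h.2⟩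
    have hd : Disjoint (t.image Sigma.fst) s := by
      rw [Finset.disjoint_left]
      intro j hj hjs
      obtain ⟨p, hp, rfl⟩ := Finset.mem_image.1 hj
      exact Finset.disjoint_left.1 ht hp (Finset.mem_sigma.2 ⟨hjs, Finset.mem_univ _⟩)
    have h1 := hs _ hd
    rw [hts, Finset.sum_sigma]
    refine lt_of_le_of_lt ((norm_sum_le _ _).trans (Finset.sum_le_sum fun j _ =>
      norm_sum_le_norm_block X f ξ (k₀ + j) _)) ?_
    exact lt_of_le_of_lt (le_abs_self _) h1
  have h1 := hsum.hasSum.sigma fun j => hasSum_fintype fun a => F ⟨j, a⟩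
  rw [hx.unique h1]
  exact hsum.hasSum

theorem hasSum_block_of_words (X : SymmetricSpace) (f : X) (ξ : List Bool → ℝ) (k₀ : ℕ) {x : X}
    (hx : HasSum (fun α : {α : List Bool // k₀ ≤ α.length} => ξ α • VMulti X α f) x) :
    HasSum (fun j => block X f ξ (k₀ + j)) x :=
  ((wordEquiv k₀).hasSum_iff.2 hx).sigma fun j =>
    hasSum_fintype fun a : Fin (k₀ + j) → Bool =>
      ξ (List.ofFn a) • VMulti X (List.ofFn a) f

/-! ### The `ℓ¹`-sum of the block spaces and its summation operator. -/

/-- The space of all blocks of level `k`. -/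
noncomputable def blockSpace (X : SymmetricSpace) (f : X) (k : ℕ) : Submodule ℝ X :=
  Submodule.span ℝ (Set.range fun a : Fin k → Bool => VMulti X (List.ofFn a) f)

theorem block_mem_blockSpace (X : SymmetricSpace) (f : X) (ξ : List Bool → ℝ) (k : ℕ) :
    block X f ξ k ∈ blockSpace X f k :=
  Submodule.sum_mem _ fun a _ =>
    Submodule.smul_mem _ _ (Submodule.subset_span (Set.mem_range_self a))

theorem exists_block_eq (X : SymmetricSpace) (f : X) {k : ℕ} {y : X}
    (hy : y ∈ blockSpace X f k) : ∃ ξ, block X f ξ k = y := by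
  obtain ⟨c, hc⟩ := (Submodule.mem_span_range_iff_exists_fun ℝ).1 hy
  have hinj : Function.Injective (fun a : Fin k → Bool => List.ofFn a) := List.ofFn_injective
  refine ⟨Function.extend (fun a : Fin k → Bool => List.ofFn a) c 0, ?_⟩
  rw [← hc, block]
  exact Finset.sum_congr rfl fun a _ => by rw [hinj.extend_apply]

instance (X : SymmetricSpace) (f : X) (k : ℕ) : FiniteDimensional ℝ (blockSpace X f k) :=
  FiniteDimensional.span_of_finite ℝ (Set.finite_range _)

/-- Makes the `ℓ¹`-sum of the block spaces complete, as `exists_preimage_of_approx` requires of its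
domain. -/
instance (X : SymmetricSpace) (f : X) (k : ℕ) : CompleteSpace (blockSpace X f k) :=
  FiniteDimensional.complete ℝ _

/-- The absolutely convergent series of blocks of levels at least `k₀`. -/
abbrev BlockSeries (X : SymmetricSpace) (f : X) (k₀ : ℕ) : Type :=
  lp (fun j : ℕ => blockSpace X f (k₀ + j)) 1

theorem BlockSeries.hasSum_norm {X : SymmetricSpace} {f : X} {k₀ : ℕ} (u : BlockSeries X f k₀) :
    HasSum (fun j => ‖(u j : X)‖) ‖u‖ := by
  have h := lp.hasSum_norm (p := 1) (by norm_num) u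
  simpa using h

/-- The sum of an absolutely convergent series of blocks. -/
noncomputable def sumBlocks (X : SymmetricSpace) (f : X) (k₀ : ℕ) : BlockSeries X f k₀ →L[ℝ] X :=
  have := X.complete
  LinearMap.mkContinuous
    { toFun := fun u => ∑' j, (u j : X)
      map_add' := fun u v => by
        rw [← u.hasSum_norm.summable.of_norm.tsum_add v.hasSum_norm.summable.of_norm]
        rfl
      map_smul' := fun c u => by
        rw [RingHom.id_apply, ← u.hasSum_norm.summable.of_norm.tsum_const_smul c]
        rfl } 1 fun u => by
    rw [one_mul, ← u.hasSum_norm.tsum_eq]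
    exact norm_tsum_le_tsum_norm u.hasSum_norm.summable

theorem hasSum_sumBlocks (X : SymmetricSpace) (f : X) (k₀ : ℕ) (u : BlockSeries X f k₀) :
    HasSum (fun j => (u j : X)) (sumBlocks X f k₀ u) :=
  have := X.complete
  u.hasSum_norm.summable.of_norm.hasSum

theorem sumBlocks_single (X : SymmetricSpace) (f : X) (k₀ j : ℕ) (y : blockSpace X f (k₀ + j)) :
    sumBlocks X f k₀ (lp.single 1 j y) = y := by
  refine (hasSum_sumBlocks X f k₀ _).unique ?_
  have h := hasSum_single (f := fun i => ((lp.single (E := fun j => blockSpace X f (k₀ + j)) 1 j y :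
    BlockSeries X f k₀) i : X)) j fun i hi => by
      simp [hi]
  simpa using h

/-- Domination of the blocks of `f` by step functions makes `{V^α f}` absolutely representing. -/
theorem isAbsRepresenting_of_norm_block_le (X : SymmetricSpace) [SeparableSpace X] (f : X)
    (hf : ∫ t, (f : L0) t ∂mI ≠ 0) {D : ℝ} (hD0 : 0 ≤ D)
    (hD : ∀ ξ k, ‖block X f ξ k‖ ≤ D * ‖step X ξ k‖) {C : ℝ}
    (hC : D / |∫ t, (f : L0) t ∂mI| < C) (k₀ : ℕ) : IsAbsRepresenting X f k₀ C := by
  intro x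
  obtain ⟨u, hu, hun⟩ := exists_preimage_of_approx (sumBlocks X f k₀)
    (D := D / |∫ t, (f : L0) t ∂mI|) (by positivity) (fun x ε hε => by
      obtain ⟨N, j, ξ, h1, h2⟩ := exists_sum_block_near X f hf hD0 hD k₀ x hε
      -- The levels `j i` may coincide: addition in the `ℓ¹`-sum merges such blocks, and the
      -- triangle inequality still bounds the norm.
      refine ⟨∑ i ∈ Finset.range N, lp.single 1 (j i) ⟨_, block_mem_blockSpace X f ξ (k₀ + j i)⟩,
        ?_, ?_⟩
      · rw [map_sum]
        simpa only [sumBlocks_single] using h1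
      · refine (norm_sum_le _ _).trans (le_trans (Finset.sum_le_sum fun i _ => ?_) h2)
        rw [lp.norm_single (by norm_num)]
        rfl) x hC
  choose ξ hξ using fun j => exists_block_eq X f (u j).2
  -- The coefficients, chosen separately for each level, are glued into one function of words: the
  -- length recovers the level.
  set ζ : List Bool → ℝ := fun α => ξ (α.length - k₀) α with hζ
  have hb : ∀ j, block X f ζ (k₀ + j) = (u j : X) := by
    intro j
    rw [← hξ j]
    refine Finset.sum_congr rfl fun a _ => ?_
    simp only [hζ, List.length_ofFn, Nat.add_sub_cancel_left]
  have hn := u.hasSum_norm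
  have hsum := hasSum_sumBlocks X f k₀ u
  rw [hu] at hsum
  simp only [← hb] at hn hsum
  exact ⟨ζ, hasSum_words X f ζ k₀ hn.summable hsum, hn.summable, hn.tsum_eq.trans_le hun⟩

/-! ### Multiplicators from absolutely representing systems -/

/-- Taking `k₀ = k` ensures that only levels `k + j` occur, so integrals over dyadic intervals of
level `k` express each coefficient of the step function through averages over later digits.
Re-expanding in `V^α f` with `|α| = k` gives a series of averaged blocks dominated by the given one.
-/
theorem norm_block_le_of_isAbsRepresenting (X : SymmetricSpace) [SeparableSpace X] (f : X)
    {C : ℝ} {k : ℕ} (h : IsAbsRepresenting X f k C) (c : List Bool → ℝ) :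
    ‖block X f c k‖ ≤ |∫ t, (f : L0) t ∂mI| * C * ‖step X c k‖ := by
  set μ := ∫ t, (f : L0) t ∂mI with hμ
  obtain ⟨ξ, hw, hs, hle⟩ := h (step X c k)
  have hB := hasSum_block_of_words X f ξ k hw
  have hα : ∀ a : Fin k → Bool,
      HasSum (fun j => μ * (avgLast^[j] ξ) (List.ofFn a)) (c (List.ofFn a)) := by
    intro a
    have hl : (List.ofFn a).length = k := List.length_ofFn
    have h1 := (integralOn X (code k ⁻¹' {List.ofFn a})).hasSum hB
    have hone : ∫ t, (X.one : L0) t ∂mI = 1 := by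
      rw [integral_congr_ae X.one_coe]
      simp
    have h2 : integralOn X (code k ⁻¹' {List.ofFn a}) (step X c k) =
        mI.real (code k ⁻¹' {List.ofFn a}) * c (List.ofFn a) := by
      have h3 := setIntegral_block X X.one c k 0 (List.ofFn a)
      rw [hone, mul_one] at h3
      exact h3
    rw [h2] at h1
    simp only [integralOn_apply, setIntegral_block X f ξ k _ (List.ofFn a)] at h1
    have hpos : mI.real (code k ⁻¹' {List.ofFn a}) ≠ 0 :=
      (ENNReal.toReal_pos (mI_code_preimage_pos hl).ne' (measure_ne_top _ _)).ne'
    -- The positive measure of the dyadic interval is a common factor of both sides and cancels.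
    rw [← hasSum_mul_left_iff hpos]
    refine h1.congr_fun ?_
    intro j
    ring
  have hsum : HasSum (fun j => μ • block X f (avgLast^[j] ξ) k) (block X f c k) := by
    have h1 := hasSum_sum (s := Finset.univ) fun (a : Fin k → Bool) _ =>
      (hα a).smul_const (VMulti X (List.ofFn a) f)
    refine h1.congr_fun fun j => ?_
    simp only [block, Finset.smul_sum, mul_smul]
  refine (hsum.norm_le_of_bounded (hs.hasSum.mul_left |μ|) fun j => ?_).trans ?_
  · rw [norm_smul, Real.norm_eq_abs]
    exact mul_le_mul_of_nonneg_left (norm_block_avgLast_iterate_le X f ξ k j) (abs_nonneg _)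
  · rw [mul_assoc]
    exact mul_le_mul_of_nonneg_left hle (abs_nonneg _)

theorem step_sub_step (X : SymmetricSpace) (ξ η : List Bool → ℝ) (k l : ℕ) :
    step X ξ k - step X η l =
      step X (fun α => ξ (α.take k) - η (α.take l)) (max k l) := by
  refine X.ext_ae ?_
  filter_upwards [sub_coe X (step X ξ k) (step X η l), step_coe X ξ k, step_coe X η l,
    step_coe X (fun α => ξ (α.take k) - η (α.take l)) (max k l)] with t h1 h2 h3 h4
  rw [h1, h2, h3, h4, take_code (le_max_left _ _), take_code (le_max_right _ _)]

/-! ### Tensor products transported to the interval, and the passage from step functions to all of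
`X`. -/

/-- The tensor product `x ⊗ y`, transported to the interval. -/
noncomputable def pullTensor {φ : ℝ → ℝ × ℝ} (hφ : MeasurePreserving φ mI (mI.prod mI))
    (x y : L0) : L0 :=
  (tensor x y).compMeasurePreserving φ hφ

theorem pullTensor_coe {φ : ℝ → ℝ × ℝ} (hφ : MeasurePreserving φ mI (mI.prod mI)) (x y : L0) :
    pullTensor hφ x y =ᵐ[mI] fun t => x (φ t).1 * y (φ t).2 := by
  filter_upwards [AEEqFun.coeFn_compMeasurePreserving (tensor x y) hφ,
    hφ.quasiMeasurePreserving.ae (tensor_coe x y)] with t h1 h2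
  exact h1.trans h2

theorem mI_lt_abs_pullTensor {φ : ℝ → ℝ × ℝ} (hφ : MeasurePreserving φ mI (mI.prod mI))
    (x y : L0) (s : ℝ) :
    mI {t | s < |pullTensor hφ x y t|} = (mI.prod mI) {p | s < |tensor x y p|} := by
  rw [pullTensor, measure_lt_abs_congr (AEEqFun.coeFn_compMeasurePreserving (tensor x y) hφ) s]
  exact hφ.measure_preimage (measurableSet_lt measurable_const
    (tensor x y).stronglyMeasurable.measurable.abs).nullMeasurableSet

theorem pullTensor_sub {φ : ℝ → ℝ × ℝ} (hφ : MeasurePreserving φ mI (mI.prod mI))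
    (x y z : L0) : pullTensor hφ x (y - z) = pullTensor hφ x y - pullTensor hφ x z := by
  refine AEEqFun.ext ?_
  filter_upwards [pullTensor_coe hφ x (y - z), pullTensor_coe hφ x y, pullTensor_coe hφ x z,
    AEEqFun.coeFn_sub (pullTensor hφ x y) (pullTensor hφ x z),
    (measurePreserving_snd.comp hφ).quasiMeasurePreserving.ae (AEEqFun.coeFn_sub y z)]
    with t h1 h2 h3 h4 h5
  rw [h1, h4, Pi.sub_apply, h2, h3, ← mul_sub]
  exact congrArg _ h5

theorem integrable_pullTensor {φ : ℝ → ℝ × ℝ} (hφ : MeasurePreserving φ mI (mI.prod mI))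
    {x y : L0} (hx : Integrable x mI) (hy : Integrable y mI) :
    Integrable (pullTensor hφ x y) mI :=
  (hφ.integrable_comp_of_integrable (hx.mul_prod hy)).congr (pullTensor_coe hφ x y).symm

theorem integral_abs_pullTensor {φ : ℝ → ℝ × ℝ} (hφ : MeasurePreserving φ mI (mI.prod mI))
    (x y : L0) : ∫ t, |pullTensor hφ x y t| ∂mI = (∫ t, |x t| ∂mI) * ∫ t, |y t| ∂mI := by
  have h1 : ∫ t, |pullTensor hφ x y t| ∂mI = ∫ t, |x (φ t).1| * |y (φ t).2| ∂mI := by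
    refine integral_congr_ae ?_
    filter_upwards [pullTensor_coe hφ x y] with t h
    rw [h, abs_mul]
  have hm : Measurable fun p : ℝ × ℝ => |x p.1| * |y p.2| :=
    ((L0.measurable x).comp measurable_fst).abs.mul ((L0.measurable y).comp measurable_snd).abs
  rw [h1, ← integral_prod_mul, ← hφ.map_eq,
    integral_map hφ.aemeasurable hm.aestronglyMeasurable]

theorem exists_pullTensor_step (X : SymmetricSpace) (f : X) {D : ℝ}
    (hD : ∀ ξ k, ‖block X f ξ k‖ ≤ D * ‖step X ξ k‖) {φ : ℝ → ℝ × ℝ}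
    (hφ : MeasurePreserving φ mI (mI.prod mI)) (ξ : List Bool → ℝ) (k : ℕ) :
    ∃ h : pullTensor hφ f (step X ξ k : X) ∈ X.space.carrier,
      ‖(⟨_, h⟩ : X)‖ ≤ D * ‖step X ξ k‖ := by
  obtain ⟨h1, h2⟩ := X.symmetric (pullTensor hφ f (step X ξ k : X)) (block X f ξ k)
    fun s _ => by rw [mI_lt_abs_pullTensor, mI_lt_abs_block_eq_tensor]
  exact ⟨h1, h2.trans_le (hD ξ k)⟩

/-- Domination of the blocks of `f` by step functions makes `f` a multiplicator. -/
theorem tensorBound_of_norm_block_le (X : SymmetricSpace) [SeparableSpace X] (f : X) {D : ℝ}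
    (hD0 : 0 ≤ D) (hD : ∀ ξ k, ‖block X f ξ k‖ ≤ D * ‖step X ξ k‖) : TensorBound X f D := by
  have := X.complete
  refine ⟨hD0, fun y => ?_⟩
  obtain ⟨φ, hφ⟩ := exists_measurePreserving_square
  choose k ξ hs using fun n : ℕ => exists_step_near X y (ε := 1 / ((n : ℝ) + 1)) (by positivity)
  set s : ℕ → X := fun n => step X (ξ n) (k n) with hsd
  have hsy : Filter.Tendsto s Filter.atTop (nhds y) := by
    rw [tendsto_iff_norm_sub_tendsto_zero]
    refine squeeze_zero (fun _ => norm_nonneg _) (fun n => ?_)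
      tendsto_one_div_add_atTop_nhds_zero_nat
    rw [norm_sub_rev]
    exact hs n
  choose hw hwn using fun n => exists_pullTensor_step X f hD hφ (ξ n) (k n)
  set w : ℕ → X := fun n => ⟨_, hw n⟩ with hwd
  -- The difference of two step functions is a step function on the common refinement, so linearity
  -- of the tensor product in its second factor carries the bound over to differences.
  have hdiff : ∀ m n, ‖w m - w n‖ ≤ D * ‖s m - s n‖ := by
    intro m n
    obtain ⟨h1, h2⟩ := exists_pullTensor_step X f hD hφ
      (fun α => ξ m (α.take (k m)) - ξ n (α.take (k n))) (max (k m) (k n))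
    have h3 : w m - w n = ⟨_, h1⟩ := by
      refine Subtype.ext ?_
      change (w m : L0) - (w n : L0) = pullTensor hφ f (step X _ (max (k m) (k n)) : X)
      rw [← step_sub_step, Submodule.coe_sub, pullTensor_sub]
    rw [h3, hsd]
    simp only [step_sub_step]
    exact h2
  have hcau : CauchySeq w := by
    rw [Metric.cauchySeq_iff]
    intro ε hε
    obtain ⟨N, hN⟩ := Metric.cauchySeq_iff.1 hsy.cauchySeq (ε / (D + 1)) (by positivity)
    refine ⟨N, fun m hm n hn => ?_⟩
    have h1 := hN m hm n hn
    rw [dist_eq_norm] at h1 ⊢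
    refine lt_of_le_of_lt (hdiff m n) ?_
    rw [lt_div_iff₀ (by positivity)] at h1
    nlinarith [norm_nonneg (s m - s n)]
  obtain ⟨v, hv⟩ := cauchySeq_tendsto_of_complete hcau
  have hp := integrable_pullTensor hφ (X.integrable f) (X.integrable y)
  -- The limit is identified in `L¹`, where the norm of a tensor product is the product of the norms
  -- and which is dominated by the norm of `X`.
  have hpv : pullTensor hφ f y = v := by
    have hle : ∀ n, ∫ t, |pullTensor hφ f y t - (v : L0) t| ∂mI ≤
        (∫ t, |(f : L0) t| ∂mI) * ‖y - s n‖ + ‖w n - v‖ := by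
      intro n
      have h1 : ∫ t, |pullTensor hφ f y t - (w n : L0) t| ∂mI ≤
          (∫ t, |(f : L0) t| ∂mI) * ‖y - s n‖ := by
        have h2 : ∫ t, |pullTensor hφ f y t - (w n : L0) t| ∂mI =
            ∫ t, |pullTensor hφ f ((y - s n : X) : L0) t| ∂mI := by
          refine integral_congr_ae ?_
          rw [Submodule.coe_sub, pullTensor_sub]
          filter_upwards [AEEqFun.coeFn_sub (pullTensor hφ f y) (pullTensor hφ f (s n : X))]
            with t h
          rw [h]
          rfl
        rw [h2, integral_abs_pullTensor]
        exact mul_le_mul_of_nonneg_left (X.integral_abs_le _)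
          (integral_nonneg fun t => abs_nonneg _)
      have h3 : ∫ t, |(w n : L0) t - (v : L0) t| ∂mI ≤ ‖w n - v‖ := by
        refine le_trans (le_of_eq (integral_congr_ae ?_)) (X.integral_abs_le (w n - v))
        filter_upwards [sub_coe X (w n) v] with t h
        rw [h]
      have hi1 : Integrable (fun t => |pullTensor hφ f y t - (w n : L0) t|) mI :=
        (hp.sub (X.integrable (w n))).abs
      have hi2 : Integrable (fun t => |(w n : L0) t - (v : L0) t|) mI :=
        ((X.integrable (w n)).sub (X.integrable v)).abs
      refine le_trans ?_ (add_le_add h1 h3)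
      rw [← integral_add hi1 hi2]
      exact integral_mono (hp.sub (X.integrable v)).abs (hi1.add hi2) fun t => abs_sub_le _ _ _
    have hlim : Filter.Tendsto
        (fun n => (∫ t, |(f : L0) t| ∂mI) * ‖y - s n‖ + ‖w n - v‖) Filter.atTop (nhds 0) := by
      have h1 := (hsy.const_sub y).norm.const_mul (∫ t, |(f : L0) t| ∂mI)
      have h2 := (hv.sub_const v).norm
      simpa using h1.add h2
    have h0 : ∫ t, |pullTensor hφ f y t - (v : L0) t| ∂mI = 0 :=
      le_antisymm (ge_of_tendsto' hlim hle) (integral_nonneg fun t => abs_nonneg _)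
    have hi : Integrable (fun t => |pullTensor hφ f y t - (v : L0) t|) mI :=
      (hp.sub (X.integrable v)).abs
    rw [integral_eq_zero_iff_of_nonneg (fun t => abs_nonneg _) hi] at h0
    refine AEEqFun.ext ?_
    filter_upwards [h0] with t ht
    exact sub_eq_zero.1 (abs_eq_zero.1 ht)
  obtain ⟨hz, hzn⟩ := squareNorm_eq X (z := tensor f y) (w := v) fun r _ => by
    rw [← hpv, mI_lt_abs_pullTensor]
  refine ⟨hz, hzn.trans_le ?_⟩
  exact le_of_tendsto_of_tendsto' hv.norm (hsy.norm.const_mul D) hwn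

end DyadicSystem

theorem theoremt2 (X : DyadicSystem.SymmetricSpace) [TopologicalSpace.SeparableSpace X] (f : X)
    (hf : ∫ t, (f : DyadicSystem.L0) t ∂DyadicSystem.mI ≠ 0) :
    ((f : DyadicSystem.L0) ∈ DyadicSystem.multiplicator X ↔
      ∃ C : ℝ, 0 < C ∧ ∀ k₀ : ℕ, DyadicSystem.IsAbsRepresenting X f k₀ C) ∧
    ((f : DyadicSystem.L0) ∈ DyadicSystem.multiplicator X →
      ∀ C : ℝ, DyadicSystem.multiplicatorNorm X f /
          |∫ t, (f : DyadicSystem.L0) t ∂DyadicSystem.mI| < C →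
        ∀ k₀ : ℕ, DyadicSystem.IsAbsRepresenting X f k₀ C) := by
  have hpos := abs_pos.2 hf
  have key : (f : DyadicSystem.L0) ∈ DyadicSystem.multiplicator X →
      ∀ C : ℝ, DyadicSystem.multiplicatorNorm X f /
          |∫ t, (f : DyadicSystem.L0) t ∂DyadicSystem.mI| < C →
        ∀ k₀ : ℕ, DyadicSystem.IsAbsRepresenting X f k₀ C := by
    intro hm C hC k₀
    rw [div_lt_iff₀ hpos] at hC
    -- The strict inequality leaves room for an actual tensor bound `D`, so the infimum need not be
    -- attained.
    obtain ⟨D, hD, hDC⟩ := exists_lt_of_csInf_lt hm hC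
    exact DyadicSystem.isAbsRepresenting_of_norm_block_le X f hf hD.1
      (DyadicSystem.norm_block_le_of_tensorBound X hD) ((div_lt_iff₀ hpos).2 hDC) k₀
  refine ⟨⟨fun hm => ?_, ?_⟩, key⟩
  · have h0 : 0 ≤ DyadicSystem.multiplicatorNorm X f := Real.sInf_nonneg fun D hD => hD.1
    exact ⟨_, add_pos_of_nonneg_of_pos (div_nonneg h0 hpos.le) one_pos,
      key hm _ (lt_add_one _)⟩
  · rintro ⟨C, hC0, hC⟩
    -- The tensor bound is `|∫ f| * C`: blocks of level `k` are handled by the system starting at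
    -- `k₀ = k`, with `C` the same for all `k`.
    exact ⟨_, DyadicSystem.tensorBound_of_norm_block_le X f (mul_nonneg hpos.le hC0.le)
      fun ξ k => DyadicSystem.norm_block_le_of_isAbsRepresenting X f (hC k) ξ⟩
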